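/- **Setting.** Let $\widehat f(\omega)=\int f(x)e^{-2\pi i\langle x,\omega\rangle}\,dx$ on $L^1(\mathbb{R}^d)$, extended to $L^2(\mathbb{R}^d)$, let $d\ge 1$, and let $B_r(0)\subseteq\mathbb{R}^d$ be the ball of radius $r$ around $0$. A module-sequence $\Omega$ consists, for every $n\in\mathbb{N}=\{1,2,\dots\}$, of a collection of filters $\{\chi_n\}\cup\{g_{\lambda_n}\}_{\lambda_n\in\Lambda_n}\subseteq L^1(\mathbb{R}^d)\cap L^2(\mathbb{R}^d)$ with $\Lambda_n$ countable. It is called Parseval if, for all $n\in\mathbb{N}$ and all $f\in L^2(\mathbb{R}^d)$, $$\|f\ast\chi_n\|_2^2+\sum_{\lambda_n\in\Lambda_n}\|f\ast g_{\lambda_n}\|_2^2=\|f\|_2^2 .$$ For $f\in L^2(\mathbb{R}^d)$ and a path $q=(\lambda_1,\dots,\lambda_n)\in\Lambda^n:=\Lambda_1\times\dots\times\Lambda_n$ let $U[q]f:=\big|\cdots\big||f\ast g_{\lambda_1}|\ast g_{\lambda_2}\big|\cdots\ast g_{\lambda_n}\big|$, with $U[e]f:=f$ for the empty path $e$, the only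 element of $\Lambda^0$. The energy of the features generated in layer $n\ge0$ is $$|||\Phi_\Omega^n(f)|||^2:=\sum_{q\in\Lambda^n}\|(U[q]f)\ast\chi_{n+1}\|_2^2 .$$ The function $f\in L^2(\mathbb{R}^d)$ is $L$-band-limited, $L\ge0$, if $\widehat f$ is supported in $B_L(0)$, i.e. $\widehat f=0$ almost everywhere outside $B_L(0)$. Consider, for $\varepsilon\in(0,1)$ and an integer $N\ge0$, the property $$1-\varepsilon\;\le\;\frac{\sum_{n=0}^{N}|||\Phi_\Omega^n(f)|||^2}{\|f\|_2^2}\;\le\;1 .\qquad(\ast)$$ **Statement.** (i) Let $\Omega$ be a Parseval module-sequence on $\mathbb{R}^d$ such that for all $n\in\mathbb{N}$ and $\lambda_n\in\Lambda_n$ there is $A_{\lambda_n}\in O(d)$ with $\mathrm{supp}(\widehat{g_{\lambda_n}})\subseteq\{A_{\lambda_n}x : x\in\mathbb{R}^d,\ x_k\ge0 \text{ for } k=1,\dots,d\}$, and let $\delta>0$ be such that $\sum_{\lambda_n\in\Lambda_n}|\widehat{g_{\lambda_n}}(\omega)|^2=0$ for a.e. $\omega\in B_\delta(0)$ and all $n\in\mathbb{N}$.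 Let $\alpha:=1$ if $d=1$ and $\alpha:=\log_2\sqrt{d/(d-1/2)}$ if $d\ge2$. Let $l>\lfloor d/2\rfloor+1$ be real, $\varepsilon\in(0,1)$, $L\ge0$, and let $f\in L^2(\mathbb{R}^d)\setminus\{0\}$ be $L$-band-limited. If $$N\ge\Bigg\lceil\Bigg(\frac{L}{(1-(1-\varepsilon)^{\frac1{2l}})\,\delta}\Bigg)^{1/\alpha}-1\Bigg\rceil ,$$ then $(\ast)$ holds. (ii) Let $d=1$ and let $\Omega$ be a Parseval module-sequence on $\mathbb{R}$ that has, in every layer, the filters of one of the following two kinds. - *Wavelets.* $\psi,\phi\in L^1(\mathbb{R})\cap L^2(\mathbb{R})$ satisfy $\mathrm{supp}(\widehat\psi)\subseteq[1/2,2]$ and $|\widehat\phi(\omega)|^2+\sum_{j=1}^\infty|\widehat\psi(2^{-j}\omega)|^2=1$ for a.e. $\omega\ge0$. The filters are $\chi=\phi$ and $\{g_j\}_{j\in\mathbb{Z}\setminus\{0\}}$ with $g_j(x)=2^j\psi(2^jx)$ for $j\ge1$ and $g_j(x)=2^{|j|}\psi(-2^{|j|}x)$ for $j\le-1$. In this case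 put $a:=5/3$ and $\delta:=1$. - *Weyl–Heisenberg filters.* $R\in\mathbb{R}$, and $g,\phi\in L^1(\mathbb{R})\cap L^2(\mathbb{R})$ satisfy $\mathrm{supp}(\widehat g)\subseteq[-R,R]$, $\widehat g(-\omega)=\widehat g(\omega)$ for all $\omega\in\mathbb{R}$, and $|\widehat\phi(\omega)|^2+\sum_{k=1}^\infty|\widehat g(\omega-R(k+1))|^2=1$ for a.e. $\omega\ge0$ (these conditions force $R>0$). The filters are $\chi=\phi$ and $\{g_k\}_{k\in\mathbb{Z}\setminus\{0\}}$ with $g_k(x)=e^{2\pi i(k+1)Rx}g(x)$ for $k\ge1$ and $g_k(x)=e^{-2\pi i(|k|+1)Rx}g(x)$ for $k\le-1$. In this case put $a:=3/2$ and $\delta:=R$. Let $l>1$ be real, $\varepsilon\in(0,1)$, $L\ge0$, and let $f\in L^2(\mathbb{R})\setminus\{0\}$ be $L$-band-limited. If $$N\ge\Bigg\lceil\log_a\Bigg(\frac{L}{(1-(1-\varepsilon)^{\frac1{2l}})\,\delta}\Bigg)\Bigg\rceil ,$$ then $(\ast)$ holds in both cases. -/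

import Mathlib

open MeasureTheory FourierTransform

noncomputable section

namespace Scattering

/-- The convolution `(f ∗ g)(y) = ∫ f(x) g(y - x) dx` of two complex-valued functions. -/
def conv {E : Type*} [AddGroup E] [MeasureSpace E] (f g : E → ℂ) : E → ℂ :=
  convolution f g (ContinuousLinearMap.mul ℂ ℂ) volume

/-- The data of one network layer: an output-generating filter `χ` and a family of filters
`g lam`, `lam ∈ Λ`. -/
structure FilterBank (E : Type*) (Λ : Type*) where
  /-- the output-generating filter -/
  χ : E → ℂ
  /-- the remaining filters -/
  g : Λ → E → ℂ

/-- All filters of the collection belong to `L¹ ∩ L²`. -/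
def FilterBank.InL1L2 {E Λ : Type*} [NormedAddCommGroup E] [MeasureSpace E]
    (Ψ : FilterBank E Λ) : Prop :=
  (MemLp Ψ.χ 1 volume ∧ MemLp Ψ.χ 2 volume) ∧
    ∀ lam, MemLp (Ψ.g lam) 1 volume ∧ MemLp (Ψ.g lam) 2 volume

/-- The frame condition
`A ‖f‖₂² ≤ ‖f ∗ χ‖₂² + ∑ ‖f ∗ g lam‖₂² ≤ B ‖f‖₂²` for all `f ∈ L²`.
Sums of squared norms are taken in `[0, ∞]`. -/
def FilterBank.FrameCondition {E Λ : Type*} [NormedAddCommGroup E] [MeasureSpace E]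
    (Ψ : FilterBank E Λ) (A B : ℝ) : Prop :=
  ∀ f : E → ℂ, MemLp f 2 volume →
    ENNReal.ofReal A * eLpNorm f 2 volume ^ 2 ≤
        eLpNorm (conv f Ψ.χ) 2 volume ^ 2 + ∑' lam, eLpNorm (conv f (Ψ.g lam)) 2 volume ^ 2 ∧
      eLpNorm (conv f Ψ.χ) 2 volume ^ 2 + ∑' lam, eLpNorm (conv f (Ψ.g lam)) 2 volume ^ 2 ≤
        ENNReal.ofReal B * eLpNorm f 2 volume ^ 2

/-- Paths of length `n`, i.e. the product of the index sets of the first `n` layers; the layers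
are numbered `0, 1, 2, …`. The only path of length `0` is the empty path. -/
def Path.{u} (Λ : ℕ → Type u) : ℕ → Type u
  | 0 => PUnit
  | n + 1 => Path Λ n × Λ n

/-- The feature map `U[q] f`: `U[e] f = f` for the empty path `e`, and
`U[(q, lam)] f = |U[q] f ∗ g lam|`. -/
def featureMap {E : Type*} [AddGroup E] [MeasureSpace E] {Λ : ℕ → Type*}
    (Ω : ∀ n, FilterBank E (Λ n)) (f : E → ℂ) : ∀ n, Path Λ n → E → ℂ
  | 0, _ => f
  | n + 1, q => fun x => ((‖conv (featureMap Ω f n q.1) ((Ω n).g q.2) x‖ : ℝ) : ℂ)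

/-- The energy `|||Φⁿ(f)|||² = ∑_q ‖U[q] f ∗ χ‖₂²` of the features generated by the paths of
length `n`; the output-generating filter `χ` is the one of the next module, which is module number
`n` when modules are numbered from `0`. -/
def featureEnergy {E : Type*} [NormedAddCommGroup E] [MeasureSpace E] {Λ : ℕ → Type*}
    (Ω : ∀ n, FilterBank E (Λ n)) (f : E → ℂ) (n : ℕ) : ENNReal :=
  ∑' q : Path Λ n, eLpNorm (conv (featureMap Ω f n q) (Ω n).χ) 2 volume ^ 2

/-- `1 - ε ≤ (∑_{n=0}^N |||Φⁿ(f)|||²) / ‖f‖₂² ≤ 1`. -/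
def CapturesEnergy {E : Type*} [NormedAddCommGroup E] [MeasureSpace E] {Λ : ℕ → Type*}
    (Ω : ∀ n, FilterBank E (Λ n)) (f : E → ℂ) (ε : ℝ) (N : ℕ) : Prop :=
  ENNReal.ofReal (1 - ε) ≤
      (∑ n ∈ Finset.range (N + 1), featureEnergy Ω f n) / eLpNorm f 2 volume ^ 2 ∧
    (∑ n ∈ Finset.range (N + 1), featureEnergy Ω f n) / eLpNorm f 2 volume ^ 2 ≤ 1

/-- `f ∈ L²` is `L`-band-limited: its (`L²`-)Fourier transform is supported in the ball of
radius `L` around `0`, i.e. vanishes almost everywhere outside of it. -/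
def BandLimited {E : Type*} [NormedAddCommGroup E] [InnerProductSpace ℝ E]
    [FiniteDimensional ℝ E] [MeasurableSpace E] [BorelSpace E]
    (f : Lp (α := E) ℂ 2 volume) (L : ℝ) : Prop :=
  ∀ᵐ ω : E, ω ∉ Metric.ball (0 : E) L → (𝓕 f : Lp (α := E) ℂ 2 volume) ω = 0

/-- The first canonical orthant of `ℝᵈ`. -/
def orthant (d : ℕ) : Set (EuclideanSpace ℝ (Fin d)) := {x | ∀ k, 0 ≤ x k}

/-- Analyticity: in every layer, the Fourier transform of every filter `g lam` is supported in some
rotated orthant `A '' orthant d`, `A ∈ O(d)`. -/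
def OrthantSupported {d : ℕ} {Λ : ℕ → Type*}
    (Ω : ∀ n, FilterBank (EuclideanSpace ℝ (Fin d)) (Λ n)) : Prop :=
  ∀ n, ∀ lam : Λ n, ∃ A : EuclideanSpace ℝ (Fin d) ≃ₗᵢ[ℝ] EuclideanSpace ℝ (Fin d),
    tsupport (𝓕 ((Ω n).g lam)) ⊆ A '' orthant d

/-- High-pass condition: in every layer, the filters `g lam` leave the spectral gap `B_δ(0)`. -/
def SpectralGap {d : ℕ} {Λ : ℕ → Type*}
    (Ω : ∀ n, FilterBank (EuclideanSpace ℝ (Fin d)) (Λ n)) (δ : ℝ) : Prop :=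
  ∀ n, ∀ᵐ ω : EuclideanSpace ℝ (Fin d), ω ∈ Metric.ball (0 : EuclideanSpace ℝ (Fin d)) δ →
    ∑' lam, ‖𝓕 ((Ω n).g lam) ω‖ₑ ^ 2 = 0

/-- The decay exponent: `1` for `d = 1` and `log₂ √(d / (d - 1/2))` for `d ≥ 2`. -/
def decayExponent (d : ℕ) : ℝ :=
  if d = 1 then 1 else Real.logb 2 (Real.sqrt ((d : ℝ) / ((d : ℝ) - 1 / 2)))

/-- The wavelet filters with father wavelet `φ` and mother wavelet `ψ`:
`χ = φ`, `g_j(x) = 2^j ψ(2^j x)` for `j ≥ 1` and `g_j(x) = 2^|j| ψ(-2^|j| x)` for `j ≤ -1`. -/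
def waveletBank (φ ψ : ℝ → ℂ) : FilterBank ℝ {j : ℤ // j ≠ 0} where
  χ := φ
  g j := fun x =>
    if 0 < j.1 then (2 : ℂ) ^ j.1.natAbs * ψ ((2 : ℝ) ^ j.1.natAbs * x)
    else (2 : ℂ) ^ j.1.natAbs * ψ (-((2 : ℝ) ^ j.1.natAbs * x))

/-- The Weyl-Heisenberg filters with low-pass filter `φ` and prototype `g`: `χ = φ`,
`g_k(x) = e^{2πi(k+1)Rx} g(x)` for `k ≥ 1` and `g_k(x) = e^{-2πi(|k|+1)Rx} g(x)` for `k ≤ -1`. -/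
def weylHeisenbergBank (R : ℝ) (φ g : ℝ → ℂ) : FilterBank ℝ {k : ℤ // k ≠ 0} where
  χ := φ
  g k := fun x =>
    if 0 < k.1 then
      Complex.exp (2 * Real.pi * Complex.I * ((k.1.natAbs : ℂ) + 1) * R * x) * g x
    else
      Complex.exp (-(2 * Real.pi * Complex.I * ((k.1.natAbs : ℂ) + 1) * R * x)) * g x

end Scattering

end

noncomputable section

namespace Scattering

/-! ### Plancherel and the convolution theorem for `L²` functions and `L¹ ∩ L²` filters -/

section FourierL2

open scoped ContDiff

variable {E : Type*} [NormedAddCommGroup E] [InnerProductSpace ℝ E] [FiniteDimensional ℝ E]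
  [MeasurableSpace E] [BorelSpace E]

/-! By the Parseval property, the energy not captured by layers `0, …, N` is the sum of `‖U[q]f‖₂²`
over the paths of length `N + 1` (`sum_featureEnergy_add`). It is bounded by following weighted
energies `∫ |û|² p` backwards through the layers.

Let `κ` be the Fourier transform of a nonnegative `h`. The triangle inequality gives `|v ∗
(modulated h)| ≤ |v| ∗ h` pointwise, so the modulus cannot decrease the energy with weight `κ²`,
even against a translate of `κ²` on the side of `v`. Total energy is preserved, so for the weight `1
- κ²` the inequality reverses (`modulusStable_one_sub_ballOverlap`). Here `κ` is a dilate of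
`ballOverlap`, the normalized autocorrelation of a ball, which is radially decreasing.

If on the support of each filter some translate of `p` lies below `p'`, then Parseval bounds the
summed `p`-energy after a layer by the `p'`-energy before it (`tsum_weightedEnergy_le`). Start from
`p₀ = 1` and take `p_{k+1}(w) = 1 - ballOverlap(w / R_k)²`. By radial monotonicity the domination
reduces to a geometric condition: a shift must shrink `‖w‖` by the factor `R_k / R_{k+1}` on the
support of the filter inside the ball of radius `R_{k+1}`, while the spectral gap settles the first
weight (`capturesEnergy_of_radii`). At the input, `(1 - ‖x‖)^l ≤ ballOverlap x` makes `p_{N+1} ≤ ε`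
on the band of `f` once `R_N` is large.

The rates come from the growth of `R_k`. Orthant supports allow `R_k = (k + 1)^α δ`
(`exists_shift_bound`); the wavelet and Weyl-Heisenberg supports allow `R_k = a^k δ`. -/

theorem continuous_fourier {f : E → ℂ} (hf : Integrable f) : Continuous (𝓕 f) :=
  VectorFourier.fourierIntegral_continuous Real.continuous_fourierChar
    (L := innerₗ E) continuous_inner hf

theorem continuous_fourierInv {f : E → ℂ} (hf : Integrable f) : Continuous (𝓕⁻ f) := by
  have h : 𝓕⁻ f = fun w => 𝓕 f (-w) := funext fun w => Real.fourierInv_eq_fourier_neg f w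
  rw [h]
  exact (continuous_fourier hf).comp continuous_neg

theorem norm_fourier_le {f : E → ℂ} (w : E) : ‖𝓕 f w‖ ≤ ∫ x, ‖f x‖ :=
  VectorFourier.norm_fourierIntegral_le_integral_norm _ _ _ _ _

/-- Two functions which are locally integrable coincide almost everywhere if they have the same
integrals against Schwartz functions. -/
theorem ae_eq_of_integral_schwartz_eq {f g : E → ℂ} (hf : LocallyIntegrable f)
    (hg : LocallyIntegrable g)
    (h : ∀ φ : SchwartzMap E ℂ, ∫ x, φ x • f x = ∫ x, φ x • g x) : f =ᵐ[volume] g := by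
  refine ae_eq_of_integral_contDiff_smul_eq hf hg fun φ hφ hc => ?_
  have hc' : HasCompactSupport (Complex.ofRealCLM ∘ φ) := hc.comp_left rfl
  have hφ' : ContDiff ℝ ∞ (Complex.ofRealCLM ∘ φ) := by fun_prop
  simpa using h (hc'.toSchwartzMap hφ')

/-- The `L²`-Fourier transform agrees with the Fourier integral on `L¹ ∩ L²`. -/
theorem fourier_toLp_ae_eq {f : E → ℂ} (h1 : MemLp f 1) (h2 : MemLp f 2) :
    (𝓕 (h2.toLp f) : Lp (α := E) ℂ 2 volume) =ᵐ[volume] 𝓕 f := by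
  have hi : Integrable f := memLp_one_iff_integrable.1 h1
  refine ae_eq_of_integral_schwartz_eq ((Lp.memLp _).locallyIntegrable (by norm_num))
    (continuous_fourier hi).locallyIntegrable fun φ => ?_
  -- The `L²` transform is tested against `φ` through its tempered distribution; the Fourier
  -- integral is then treated by moving the transform onto `φ`.
  have key := congrArg (fun T => T φ) (Lp.fourier_toTemperedDistribution_eq (h2.toLp f))
  simp only [TemperedDistribution.fourier_apply, Lp.toTemperedDistribution_apply] at key
  rw [← key]
  have h3 : ∫ x, (𝓕 φ) x • (h2.toLp f) x = ∫ x, (𝓕 φ) x • f x := by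
    refine integral_congr_ae ?_
    filter_upwards [h2.coeFn_toLp] with x hx
    rw [hx]
  rw [h3, SchwartzMap.fourier_coe]
  exact VectorFourier.integral_fourierIntegral_smul_eq_flip (L := innerₗ E)
    Real.continuous_fourierChar continuous_inner φ.integrable hi |>.trans (by
      rw [flip_innerₗ]; rfl)

/-- The inverse `L²`-Fourier transform agrees with the inverse Fourier integral on `L¹ ∩ L²`. -/
theorem fourierInv_toLp_ae_eq {f : E → ℂ} (h1 : MemLp f 1) (h2 : MemLp f 2) :
    (𝓕⁻ (h2.toLp f) : Lp (α := E) ℂ 2 volume) =ᵐ[volume] 𝓕⁻ f := by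
  have hi : Integrable f := memLp_one_iff_integrable.1 h1
  refine ae_eq_of_integral_schwartz_eq ((Lp.memLp _).locallyIntegrable (by norm_num))
    (continuous_fourierInv hi).locallyIntegrable fun φ => ?_
  have key := congrArg (fun T => T φ) (Lp.fourierInv_toTemperedDistribution_eq (h2.toLp f))
  simp only [TemperedDistribution.fourierInv_apply, Lp.toTemperedDistribution_apply] at key
  rw [← key]
  have h3 : ∫ x, (𝓕⁻ φ) x • (h2.toLp f) x = ∫ x, (𝓕⁻ φ) x • f x := by
    refine integral_congr_ae ?_
    filter_upwards [h2.coeFn_toLp] with x hx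
    rw [hx]
  rw [h3, SchwartzMap.fourierInv_coe]
  have hL : (-innerₗ E).flip = -innerₗ E := by
    ext x y
    simp [real_inner_comm]
  exact VectorFourier.integral_fourierIntegral_smul_eq_flip (L := -innerₗ E)
    Real.continuous_fourierChar (by
      have : Continuous fun p : E × E => -inner ℝ p.1 p.2 := by fun_prop
      simpa using this) φ.integrable hi |>.trans (by rw [hL]; rfl)

open Classical in
/-- The `L²`-Fourier transform of a function (`0` for functions which are not in `L²`). -/
def l2Fourier (u : E → ℂ) : E → ℂ :=
  if h : MemLp u 2 volume then (𝓕 (h.toLp u) : Lp (α := E) ℂ 2 volume) else 0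

theorem l2Fourier_eq {u : E → ℂ} (h : MemLp u 2) :
    l2Fourier u = (𝓕 (h.toLp u) : Lp (α := E) ℂ 2 volume) := by
  simp [l2Fourier, h]

theorem memLp_l2Fourier {u : E → ℂ} (h : MemLp u 2) : MemLp (l2Fourier u) 2 := by
  rw [l2Fourier_eq h]
  exact Lp.memLp _

theorem l2Fourier_ae_eq_fourier {u : E → ℂ} (h1 : MemLp u 1) (h : MemLp u 2) :
    l2Fourier u =ᵐ[volume] 𝓕 u := by
  rw [l2Fourier_eq h]
  exact fourier_toLp_ae_eq h1 h

theorem lintegral_enorm_sq (u : E → ℂ) : ∫⁻ x, ‖u x‖ₑ ^ 2 = eLpNorm u 2 volume ^ 2 := by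
  have := eLpNorm_nnreal_pow_eq_lintegral (p := 2) (f := u) (μ := volume) (by norm_num)
  simpa using this.symm

theorem eLpNorm_l2Fourier {u : E → ℂ} (h : MemLp u 2) :
    eLpNorm (l2Fourier u) 2 volume = eLpNorm u 2 volume := by
  rw [l2Fourier_eq h, ← eLpNorm_congr_ae h.coeFn_toLp, ← Lp.enorm_def, ← Lp.enorm_def,
    ← ofReal_norm, ← ofReal_norm, Lp.norm_fourier_eq]

theorem exists_l2Fourier_ae_eq {F : E → ℂ} (h : MemLp F 2) :
    ∃ w : E → ℂ, MemLp w 2 ∧ l2Fourier w =ᵐ[volume] F := by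
  refine ⟨(𝓕⁻ (h.toLp F) : Lp (α := E) ℂ 2 volume), Lp.memLp _, ?_⟩
  rw [l2Fourier_eq (Lp.memLp _), Lp.toLp_coeFn, fourier_fourierInv_eq]
  exact h.coeFn_toLp

theorem integral_conj_mul_l2Fourier {u v : E → ℂ} (hu : MemLp u 2) (hv : MemLp v 2) :
    ∫ x, l2Fourier v x * starRingEnd ℂ (l2Fourier u x) = ∫ x, v x * starRingEnd ℂ (u x) := by
  have h := Lp.inner_fourier_eq (hu.toLp u) (hv.toLp v)
  rw [L2.inner_def, L2.inner_def] at h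
  rw [l2Fourier_eq hu, l2Fourier_eq hv]
  simp only [RCLike.inner_apply] at h
  rw [h]
  refine integral_congr_ae ?_
  filter_upwards [hu.coeFn_toLp, hv.coeFn_toLp] with x h1 h2
  rw [h1, h2]

theorem fourier_conj_sub_left (g : E → ℂ) (x w : E) :
    𝓕 (fun t => starRingEnd ℂ (g (x - t))) w =
      starRingEnd ℂ (Real.fourierChar (inner ℝ w x) * 𝓕 g w) := by
  have h1 : 𝓕 (fun t => starRingEnd ℂ (g (x - t))) w =
      ∫ s, (Real.fourierChar (-inner ℝ (x - s) w) : ℂ) * starRingEnd ℂ (g s) := by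
    rw [Real.fourier_eq, ← integral_sub_left_eq_self _ volume x]
    simp [Circle.smul_def]
  rw [h1, Real.fourier_eq, ← integral_const_mul, ← integral_conj]
  refine integral_congr_ae (Filter.Eventually.of_forall fun s => ?_)
  simp only [Circle.smul_def, smul_eq_mul, map_mul, ← Circle.coe_inv_eq_conj,
    ← AddChar.map_neg_eq_inv, neg_neg]
  rw [← mul_assoc, ← Circle.coe_mul, ← AddChar.map_add_eq_mul]
  congr 4
  rw [inner_sub_left, real_inner_comm w x]
  ring

theorem memLp_comp_sub_left {g : E → ℂ} {p : ENNReal} (hg : MemLp g p) (x : E) :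
    MemLp (fun t => g (x - t)) p :=
  hg.comp_measurePreserving (Measure.measurePreserving_sub_left volume x)

/-- For fixed `x`, the convolution is the `L²` pairing of `u` with `t ↦ conj (g (x - t))`.
Plancherel turns this pairing into the inverse Fourier integral, which gives a pointwise identity
and not only an almost-everywhere one. -/
theorem conv_eq_fourierInv {u g : E → ℂ} (hu : MemLp u 2) (h1 : MemLp g 1) (h2 : MemLp g 2) :
    conv u g = 𝓕⁻ (fun w => l2Fourier u w * 𝓕 g w) := by
  ext x
  have ha := memLp_comp_sub_left h1 x
  have hb := memLp_comp_sub_left h2 x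
  have hp := integral_conj_mul_l2Fourier hb.star hu
  have e1 : conv u g x = ∫ t, u t * starRingEnd ℂ (star (fun t => g (x - t)) t) := by
    simp [conv, convolution]
  rw [e1, ← hp, Real.fourierInv_eq]
  refine integral_congr_ae ?_
  filter_upwards [l2Fourier_ae_eq_fourier ha.star hb.star] with w hw
  have hs : (star fun t => g (x - t)) = fun t => starRingEnd ℂ (g (x - t)) := by
    ext t; simp
  rw [hw, hs, fourier_conj_sub_left]
  simp [Circle.smul_def]
  ring

theorem memLp_l2Fourier_mul {u g : E → ℂ} (hu : MemLp u 2) (h1 : MemLp g 1) :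
    MemLp (fun w => l2Fourier u w * 𝓕 g w) 2 := by
  have hi : Integrable g := memLp_one_iff_integrable.1 h1
  refine (memLp_l2Fourier hu).of_le_mul (c := ∫ x, ‖g x‖)
    ((memLp_l2Fourier hu).1.mul (continuous_fourier hi).aestronglyMeasurable)
    (Filter.Eventually.of_forall fun w => ?_)
  rw [norm_mul, mul_comm]
  exact mul_le_mul_of_nonneg_right (norm_fourier_le w) (norm_nonneg _)

theorem fourierInv_toLp_mul_ae_eq_conv {u g : E → ℂ} (hu : MemLp u 2) (h1 : MemLp g 1)
    (h2 : MemLp g 2) :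
    (𝓕⁻ ((memLp_l2Fourier_mul hu h1).toLp _) : Lp (α := E) ℂ 2 volume) =ᵐ[volume]
      conv u g := by
  have hg : MemLp (𝓕 g) 2 :=
    (memLp_congr_ae (l2Fourier_ae_eq_fourier h1 h2)).1 (memLp_l2Fourier h2)
  have hm : MemLp (fun w => l2Fourier u w * 𝓕 g w) 1 := hg.mul (memLp_l2Fourier hu)
  rw [conv_eq_fourierInv hu h1 h2]
  exact fourierInv_toLp_ae_eq hm _

theorem memLp_conv {u g : E → ℂ} (hu : MemLp u 2) (h1 : MemLp g 1) (h2 : MemLp g 2) :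
    MemLp (conv u g) 2 :=
  (memLp_congr_ae (fourierInv_toLp_mul_ae_eq_conv hu h1 h2)).1 (Lp.memLp _)

/-- The convolution theorem for the convolution of an `L²`-function with a filter. -/
theorem l2Fourier_conv {u g : E → ℂ} (hu : MemLp u 2) (h1 : MemLp g 1) (h2 : MemLp g 2) :
    l2Fourier (conv u g) =ᵐ[volume] fun w => l2Fourier u w * 𝓕 g w := by
  have h := fourierInv_toLp_mul_ae_eq_conv hu h1 h2
  rw [l2Fourier_eq (memLp_conv hu h1 h2)]
  have e : (memLp_conv hu h1 h2).toLp (conv u g) =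
      𝓕⁻ ((memLp_l2Fourier_mul hu h1).toLp _) := by
    refine Lp.ext ?_
    filter_upwards [(memLp_conv hu h1 h2).coeFn_toLp, h] with x hx hx'
    rw [hx, hx']
  rw [e, fourier_fourierInv_eq]
  exact MemLp.coeFn_toLp _

theorem eLpNorm_conv_sq {u g : E → ℂ} (hu : MemLp u 2) (h1 : MemLp g 1) (h2 : MemLp g 2) :
    eLpNorm (conv u g) 2 volume ^ 2 = ∫⁻ w, ‖l2Fourier u w‖ₑ ^ 2 * ‖𝓕 g w‖ₑ ^ 2 := by
  rw [← eLpNorm_l2Fourier (memLp_conv hu h1 h2), ← lintegral_enorm_sq]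
  refine lintegral_congr_ae ?_
  filter_upwards [l2Fourier_conv hu h1 h2] with w hw
  rw [hw, enorm_mul, mul_pow]

end FourierL2

/-! ### The ball overlap function: monotonicity, positive definiteness, lower bounds -/

section BallOverlap

variable {E : Type*} [NormedAddCommGroup E] [InnerProductSpace ℝ E] [FiniteDimensional ℝ E]
  [MeasurableSpace E] [BorelSpace E]

open Metric
open scoped Pointwise

/-- The relative volume of the intersection of two balls of radius `1/2` with centres
`0` and `w`. This radial function is positive definite. -/
def ballOverlap (w : E) : ℝ :=
  volume.real (ball (0 : E) (1 / 2) ∩ ball w (1 / 2)) / volume.real (ball (0 : E) (1 / 2))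

theorem volume_real_ball_pos {r : ℝ} (hr : 0 < r) : 0 < volume.real (ball (0 : E) r) :=
  ENNReal.toReal_pos (measure_ball_pos volume 0 hr).ne' measure_ball_lt_top.ne

theorem ballOverlap_nonneg (w : E) : 0 ≤ ballOverlap w := by
  unfold ballOverlap; positivity

theorem ballOverlap_le_one (w : E) : ballOverlap w ≤ 1 :=
  div_le_one_of_le₀ (measureReal_mono Set.inter_subset_left measure_ball_lt_top.ne)
    measureReal_nonneg

theorem ballOverlap_zero : ballOverlap (0 : E) = 1 := by
  unfold ballOverlap
  rw [Set.inter_self, div_self (volume_real_ball_pos (by norm_num)).ne']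

theorem ballOverlap_eq_zero {w : E} (hw : 1 ≤ ‖w‖) : ballOverlap w = 0 := by
  have h : ball (0 : E) (1 / 2) ∩ ball w (1 / 2) = ∅ :=
    (ball_disjoint_ball (by rw [dist_zero_left]; linarith)).inter_eq
  rw [ballOverlap, h, measureReal_empty, zero_div]

/-- The lens-shaped intersection, centred at the origin. -/
theorem ballOverlap_eq_lens (w : E) :
    ballOverlap w = volume.real {x : E | ‖x + (1 / 2 : ℝ) • w‖ < 1 / 2 ∧
      ‖x - (1 / 2 : ℝ) • w‖ < 1 / 2} / volume.real (ball (0 : E) (1 / 2)) := by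
  unfold ballOverlap
  congr 1
  unfold Measure.real
  congr 1
  rw [← measure_preimage_add_right volume ((1 / 2 : ℝ) • w)]
  congr 1
  ext x
  simp only [Set.mem_preimage, Set.mem_inter_iff, mem_ball, dist_eq_norm, sub_zero,
    Set.mem_ofPred_eq]
  have : x + (1 / 2 : ℝ) • w - w = x - (1 / 2 : ℝ) • w := by module
  rw [this]

theorem ballOverlap_map (A : E ≃ₗᵢ[ℝ] E) (w : E) : ballOverlap (A w) = ballOverlap w := by
  unfold ballOverlap
  congr 1
  unfold Measure.real
  congr 1
  have h := A.measurePreserving.measure_preimage_emb A.toHomeomorph.measurableEmbedding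
    (ball (0 : E) (1 / 2) ∩ ball (A w) (1 / 2))
  rw [← h]
  congr 1
  ext x
  simp [dist_eq_norm]

/-- Centred at the midpoint, the lens of `c • w` lies inside the lens of `w`: the points `x ± w/2`
are convex combinations of `x + cw/2` and `x - cw/2`, which lie in a convex ball. -/
theorem ballOverlap_smul_le {c : ℝ} (hc : 1 ≤ c) (w : E) :
    ballOverlap (c • w) ≤ ballOverlap w := by
  rw [ballOverlap_eq_lens, ballOverlap_eq_lens]
  refine div_le_div_of_nonneg_right (measureReal_mono ?_ ?_) measureReal_nonneg
  · rintro x ⟨h1, h2⟩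
    have c0 : 0 < c := by linarith
    have ha : 0 ≤ (1 + c⁻¹) / 2 := by positivity
    have hb : 0 ≤ (1 - c⁻¹) / 2 := by
      have := inv_le_one_of_one_le₀ hc
      linarith
    have hab : (1 + c⁻¹) / 2 + (1 - c⁻¹) / 2 = 1 := by ring
    have e1 : x + (1 / 2 : ℝ) • w = ((1 + c⁻¹) / 2) • (x + (1 / 2 : ℝ) • c • w) +
        ((1 - c⁻¹) / 2) • (x - (1 / 2 : ℝ) • c • w) := by
      match_scalars <;> field_simp <;> ring
    have e2 : x - (1 / 2 : ℝ) • w = ((1 + c⁻¹) / 2) • (x - (1 / 2 : ℝ) • c • w) +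
        ((1 - c⁻¹) / 2) • (x + (1 / 2 : ℝ) • c • w) := by
      match_scalars <;> field_simp <;> ring
    have m1 := mem_ball_zero_iff.2 h1
    have m2 := mem_ball_zero_iff.2 h2
    refine ⟨?_, ?_⟩
    · rw [e1]
      exact mem_ball_zero_iff.1 (convex_ball (0 : E) (1 / 2) m1 m2 ha hb hab)
    · rw [e2]
      exact mem_ball_zero_iff.1 (convex_ball (0 : E) (1 / 2) m2 m1 ha hb hab)
  · refine ((measure_mono (t := ball (-((1 / 2 : ℝ) • w)) (1 / 2)) ?_).trans_lt
      measure_ball_lt_top).ne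
    rintro x ⟨h1, -⟩
    simpa [mem_ball, dist_eq_norm] using h1

/-- A reflection carries `w` to the multiple of `v` with the same norm, which reduces the claim to
monotonicity along a ray. -/
theorem ballOverlap_anti {v w : E} (h : ‖v‖ ≤ ‖w‖) : ballOverlap w ≤ ballOverlap v := by
  rcases eq_or_ne v 0 with rfl | hv
  · rw [ballOverlap_zero]
    exact ballOverlap_le_one w
  · have hv' : 0 < ‖v‖ := norm_pos_iff.2 hv
    have hn : ‖w‖ = ‖(‖w‖ / ‖v‖) • v‖ := by
      rw [norm_smul, norm_div, norm_norm, norm_norm, div_mul_cancel₀ _ hv'.ne']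
    have hr := Submodule.reflection_sub hn
    rw [← ballOverlap_map ((ℝ ∙ (w - (‖w‖ / ‖v‖) • v))ᗮ.reflection) w, hr]
    exact ballOverlap_smul_le ((one_le_div hv').2 h) v

theorem volume_inter_ball_div {R : ℝ} (hR : 0 < R) (w : E) :
    volume.real (ball (0 : E) (R / 2) ∩ ball w (R / 2)) / volume.real (ball (0 : E) (R / 2)) =
      ballOverlap (R⁻¹ • w) := by
  have h0 : ball (0 : E) (R / 2) = R • ball (0 : E) (1 / 2) := by
    rw [_root_.smul_ball hR.ne']
    simp [abs_of_pos hR, div_eq_mul_inv]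
  have h1 : ball w (R / 2) = R • ball (R⁻¹ • w) (1 / 2) := by
    rw [_root_.smul_ball hR.ne', smul_inv_smul₀ hR.ne']
    simp [abs_of_pos hR, div_eq_mul_inv]
  unfold ballOverlap
  rw [h0, h1, ← Set.smul_set_inter₀ hR.ne']
  unfold Measure.real
  rw [Measure.addHaar_smul, Measure.addHaar_smul, ENNReal.toReal_mul, ENNReal.toReal_mul]
  refine mul_div_mul_left _ _ ?_
  rw [ENNReal.toReal_ofReal (abs_nonneg _)]
  positivity

theorem fourier_comp_sub_right (f : E → ℂ) (w x : E) :
    𝓕 (fun t => f (t - w)) x = Real.fourierChar (-inner ℝ w x) * 𝓕 f x := by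
  rw [Real.fourier_eq, ← integral_add_right_eq_self _ w, Real.fourier_eq, ← integral_const_mul]
  refine integral_congr_ae (Filter.Eventually.of_forall fun s => ?_)
  simp only [Circle.smul_def, smul_eq_mul, add_sub_cancel_right]
  rw [← mul_assoc, ← Circle.coe_mul, ← AddChar.map_add_eq_mul, inner_add_left]
  congr 3
  ring_nf

/-- The dilated ball overlap function is the Fourier transform of a nonnegative function. -/
theorem exists_fourier_eq_ballOverlap {R : ℝ} (hR : 0 < R) :
    ∃ h : E → ℝ, (∀ x, 0 ≤ h x) ∧ MemLp (fun x => (h x : ℂ)) 1 ∧ MemLp (fun x => (h x : ℂ)) 2 ∧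
      ∀ w, 𝓕 (fun x => (h x : ℂ)) w = ballOverlap (R⁻¹ • w) := by
  set V := volume.real (ball (0 : E) (R / 2))
  have hVpos : 0 < V := volume_real_ball_pos (by positivity)
  have hVc : (V : ℂ) ≠ 0 := by exact_mod_cast hVpos.ne'
  set b : E → ℂ := (ball (0 : E) (R / 2)).indicator 1 with hb
  have hbp : ∀ p, MemLp b p := fun p =>
    memLp_indicator_const p measurableSet_ball 1 (Or.inr measure_ball_lt_top.ne)
  have hb2 : MemLp (𝓕 b) 2 :=
    (memLp_congr_ae (l2Fourier_ae_eq_fourier (hbp 1) (hbp 2))).1 (memLp_l2Fourier (hbp 2))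
  have hint : Integrable (fun x => ‖𝓕 b x‖ ^ 2) := by
    simpa using hb2.integrable_norm_pow (by norm_num)
  have hi1 : Integrable (fun x => ((‖𝓕 b x‖ ^ 2 / V : ℝ) : ℂ)) := (hint.div_const V).ofReal
  -- The overlap is the normalized autocorrelation of the indicator `b`, so the natural candidate is
  -- `|𝓕 b|² / V`. Plancherel for `b` and its translate by `w` identifies its transform.
  refine ⟨fun x => ‖𝓕 b x‖ ^ 2 / V, fun x => by positivity, memLp_one_iff_integrable.2 hi1, ?_,
    fun w => ?_⟩
  · refine hb2.of_le_mul (c := (∫ x, ‖b x‖) / V) hi1.1 (Filter.Eventually.of_forall fun x => ?_)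
    rw [Complex.norm_real, Real.norm_of_nonneg (by positivity)]
    beta_reduce
    rw [pow_two, mul_div_right_comm]
    exact mul_le_mul_of_nonneg_right
      (div_le_div_of_nonneg_right (norm_fourier_le x) hVpos.le) (norm_nonneg _)
  · have hbw : ∀ p, MemLp (fun t => b (t - w)) p := fun p =>
      (hbp p).comp_measurePreserving (measurePreserving_sub_right volume w)
    have key := integral_conj_mul_l2Fourier (hbp 2) (hbw 2)
    rw [← volume_inter_ball_div hR, Real.fourier_eq]
    have e1 : ∫ x, b (x - w) * starRingEnd ℂ (b x) =
        (volume.real (ball (0 : E) (R / 2) ∩ ball w (R / 2)) : ℂ) := by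
      have : ∀ x, b (x - w) * starRingEnd ℂ (b x) =
          (ball (0 : E) (R / 2) ∩ ball w (R / 2)).indicator (fun _ => (1 : ℂ)) x := by
        intro x
        by_cases h1 : x ∈ ball (0 : E) (R / 2) <;> by_cases h2 : x ∈ ball w (R / 2) <;>
          simp_all [dist_eq_norm]
      simp only [this]
      rw [integral_indicator_const _ (measurableSet_ball.inter measurableSet_ball)]
      simp
    have e2 : ∫ x, l2Fourier (fun t => b (t - w)) x * starRingEnd ℂ (l2Fourier b x) =
        ∫ x, (V : ℂ) * (Real.fourierChar (-inner ℝ x w) • ((‖𝓕 b x‖ ^ 2 / V : ℝ) : ℂ)) := by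
      refine integral_congr_ae ?_
      filter_upwards [l2Fourier_ae_eq_fourier (hbp 1) (hbp 2),
        l2Fourier_ae_eq_fourier (hbw 1) (hbw 2)] with x h1 h2
      rw [h1, h2, fourier_comp_sub_right, mul_assoc, Complex.mul_conj, Complex.normSq_eq_norm_sq,
        real_inner_comm x w, Circle.smul_def, smul_eq_mul]
      push_cast
      rw [mul_left_comm, mul_div_cancel₀ _ hVc]
    rw [e1, e2, integral_const_mul] at key
    rw [Complex.ofReal_div, ← key, mul_div_cancel_left₀]
    exact hVc

theorem measurable_ballOverlap {R : ℝ} (hR : 0 < R) :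
    Measurable fun w : E => ballOverlap (R⁻¹ • w) := by
  obtain ⟨h, -, h1, -, hF⟩ := exists_fourier_eq_ballOverlap (E := E) hR
  have hc := continuous_fourier (memLp_one_iff_integrable.1 h1)
  have : (fun w : E => ballOverlap (R⁻¹ • w)) = fun w => (𝓕 (fun x => (h x : ℂ)) w).re := by
    ext w
    rw [hF w, Complex.ofReal_re]
  rw [this]
  exact (Complex.continuous_re.comp hc).measurable

theorem one_sub_abs_le_ballOverlap (w : ℝ) : 1 - |w| ≤ ballOverlap w := by
  have hsub : ball (w / 2) ((1 - |w|) / 2) ⊆ ball (0 : ℝ) (1 / 2) ∩ ball w (1 / 2) := by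
    intro x hx
    rw [Real.ball_eq_Ioo] at hx
    simp only [Real.ball_eq_Ioo, Set.mem_inter_iff, Set.mem_Ioo] at hx ⊢
    have h1 := le_abs_self w
    have h2 := neg_abs_le w
    refine ⟨⟨?_, ?_⟩, ?_, ?_⟩ <;> linarith
  have hm := measureReal_mono (μ := volume) hsub
    ((measure_mono Set.inter_subset_left).trans_lt measure_ball_lt_top).ne
  unfold ballOverlap
  have h1 : volume.real (ball (0 : ℝ) (1 / 2)) = 1 := by
    simp [Measure.real, Real.volume_ball]
  rw [h1, div_one]
  refine le_trans ?_ hm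
  rw [Measure.real, Real.volume_ball, ENNReal.toReal_ofReal']
  refine le_trans (le_of_eq ?_) (le_max_left _ _)
  ring

theorem rpow_le_ballOverlap_real {l : ℝ} (hl : 1 ≤ l) {w : ℝ} (hw : ‖w‖ < 1) :
    (1 - ‖w‖) ^ l ≤ ballOverlap w := by
  refine le_trans ?_ (one_sub_abs_le_ballOverlap w)
  rw [← Real.norm_eq_abs]
  conv_rhs => rw [← Real.rpow_one (1 - ‖w‖)]
  exact Real.rpow_le_rpow_of_exponent_ge (by linarith) (by linarith [norm_nonneg w]) hl

/-- The lens contains an ellipsoid, the image of the ball under a diagonal map with factor `1 - ρ`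
along the axis and `√(1 - ρ)` across it. The determinant of this map is the volume ratio. -/
theorem mul_sqrt_pow_le_ballOverlap {n : ℕ} {w : EuclideanSpace ℝ (Fin (n + 1))} (hw : ‖w‖ < 1) :
    (1 - ‖w‖) * Real.sqrt (1 - ‖w‖) ^ n ≤ ballOverlap w := by
  set ρ := ‖w‖
  have hρ0 : 0 ≤ ρ := norm_nonneg w
  set D : Fin (n + 1) → ℝ := Fin.cons (1 - ρ) fun _ => Real.sqrt (1 - ρ) with hD
  set T := Matrix.toEuclideanLin (Matrix.diagonal D) with hT
  have hdet : LinearMap.det T = (1 - ρ) * Real.sqrt (1 - ρ) ^ n := by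
    rw [hT, Matrix.toEuclideanLin_eq_toLin_orthonormal, LinearMap.det_toLin, Matrix.det_diagonal,
      Fin.prod_univ_succ]
    simp [hD]
  set e : EuclideanSpace ℝ (Fin (n + 1)) := EuclideanSpace.single 0 ρ with he
  have hen : ‖e‖ = ρ := by simp [he, abs_of_nonneg hρ0]
  have hsub : T '' ball 0 (1 / 2) ⊆ {x | ‖x + (1 / 2 : ℝ) • e‖ < 1 / 2 ∧
      ‖x - (1 / 2 : ℝ) • e‖ < 1 / 2} := by
    rintro _ ⟨x, hx, rfl⟩
    rw [mem_ball_zero_iff] at hx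
    have hx2 : ‖x‖ ^ 2 < 1 / 4 := by nlinarith [norm_nonneg x]
    have hsq : Real.sqrt (1 - ρ) ^ 2 = 1 - ρ := Real.sq_sqrt (by linarith)
    rw [EuclideanSpace.real_norm_sq_eq, Fin.sum_univ_succ] at hx2
    have key : ∀ s : ℝ, s ^ 2 = 1 / 4 → ‖T x + s • e‖ < 1 / 2 := by
      intro s hs
      refine lt_of_pow_lt_pow_left₀ 2 (by norm_num) ?_
      rw [EuclideanSpace.real_norm_sq_eq, Fin.sum_univ_succ]
      have hz : ∀ i, (T x + s • e).ofLp i = D i * x i + s * e i := by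
        intro i
        simp [hT, Matrix.toLpLin_apply, Matrix.mulVec_diagonal]
      simp only [hz]
      have h1 : ∀ i : Fin n, (D i.succ * x i.succ + s * e i.succ) ^ 2 =
          (1 - ρ) * x i.succ ^ 2 := by
        intro i
        simp [hD, he, mul_pow, hsq]
      simp only [h1, ← Finset.mul_sum]
      have h0 : D 0 = 1 - ρ := by simp [hD]
      have h2 : e 0 = ρ := by simp [he]
      rw [h0, h2]
      -- With `∑ xᵢ² < 1/4`, the squared norm is below `1/4 - ρ (1 - ρ) (x₀ - s)²`.
      nlinarith [mul_nonneg (mul_nonneg hρ0 (sub_nonneg.2 hw.le)) (sq_nonneg (x 0 - s))]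
    refine ⟨key _ (by norm_num), ?_⟩
    have := key (-(1 / 2)) (by norm_num)
    rwa [neg_smul, ← sub_eq_add_neg] at this
  have hle : ballOverlap e ≤ ballOverlap w := ballOverlap_anti (by rw [hen])
  refine le_trans ?_ hle
  rw [ballOverlap_eq_lens, le_div_iff₀ (volume_real_ball_pos (by norm_num))]
  have hfin : volume {x : EuclideanSpace ℝ (Fin (n + 1)) | ‖x + (1 / 2 : ℝ) • e‖ < 1 / 2 ∧
      ‖x - (1 / 2 : ℝ) • e‖ < 1 / 2} ≠ ⊤ := by
    refine ((measure_mono (t := ball (-((1 / 2 : ℝ) • e)) (1 / 2)) ?_).trans_lt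
      measure_ball_lt_top).ne
    rintro x ⟨h1, -⟩
    simpa [mem_ball, dist_eq_norm] using h1
  refine le_trans (le_of_eq ?_) (measureReal_mono hsub hfin)
  have hpos : 0 ≤ (1 - ρ) * Real.sqrt (1 - ρ) ^ n := by
    have : 0 ≤ 1 - ρ := by linarith
    positivity
  rw [Measure.real, Measure.real, Measure.addHaar_image_linearMap, ENNReal.toReal_mul, hdet,
    ENNReal.toReal_ofReal (abs_nonneg _), abs_of_nonneg hpos]

/-- The ellipsoid bound is `(1 - ‖w‖)^((d + 1)/2)`, and `(d + 1)/2 ≤ ⌊d/2⌋ + 1 ≤ l`. -/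
theorem rpow_le_ballOverlap {d : ℕ} (hd : 1 ≤ d) {l : ℝ} (hl : ((d / 2 : ℕ) : ℝ) + 1 ≤ l)
    {w : EuclideanSpace ℝ (Fin d)} (hw : ‖w‖ < 1) : (1 - ‖w‖) ^ l ≤ ballOverlap w := by
  obtain ⟨n, rfl⟩ : ∃ n, d = n + 1 := ⟨d - 1, by omega⟩
  refine le_trans ?_ (mul_sqrt_pow_le_ballOverlap hw)
  have h0 : 0 < 1 - ‖w‖ := by linarith
  have e : (1 - ‖w‖) * Real.sqrt (1 - ‖w‖) ^ n = (1 - ‖w‖) ^ ((n : ℝ) / 2 + 1) := by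
    rw [Real.sqrt_eq_rpow, ← Real.rpow_natCast, ← Real.rpow_mul h0.le, Real.rpow_add h0,
      Real.rpow_one, mul_comm]
    congr 2
    ring
  rw [e]
  refine Real.rpow_le_rpow_of_exponent_ge h0 (by linarith [norm_nonneg w]) ?_
  have : (n : ℝ) ≤ 2 * (((n + 1) / 2 : ℕ) : ℝ) := by
    have : n ≤ 2 * ((n + 1) / 2) := by omega
    exact_mod_cast this
  linarith

end BallOverlap

/-! ### Weighted energies under the modulus and under one layer -/

section Energy

variable {E : Type*} [NormedAddCommGroup E] [InnerProductSpace ℝ E] [FiniteDimensional ℝ E]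
  [MeasurableSpace E] [BorelSpace E]

/-- The modulus `|v|` as a complex-valued function. -/
abbrev modulus (v : E → ℂ) : E → ℂ := fun x => ((‖v x‖ : ℝ) : ℂ)

theorem memLp_modulus {v : E → ℂ} {p : ENNReal} (hv : MemLp v p) : MemLp (modulus v) p :=
  hv.norm.ofReal

theorem eLpNorm_modulus (v : E → ℂ) (p : ENNReal) :
    eLpNorm (modulus v) p volume = eLpNorm v p volume :=
  eLpNorm_congr_norm_ae (Filter.Eventually.of_forall fun x => by simp)

/-- The energy of `u ∈ L²` weighted by `p` in the frequency domain. -/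
def weightedEnergy (p : E → ℝ) (u : E → ℂ) : ENNReal :=
  ∫⁻ w, ‖l2Fourier u w‖ₑ ^ 2 * ENNReal.ofReal (p w)

theorem weightedEnergy_one {u : E → ℂ} (hu : MemLp u 2) :
    weightedEnergy (fun _ => 1) u = eLpNorm u 2 volume ^ 2 := by
  rw [← eLpNorm_l2Fourier hu, ← lintegral_enorm_sq]
  simp [weightedEnergy]

theorem weightedEnergy_one_sub_add {u : E → ℂ} (hu : MemLp u 2) {q : E → ℝ} (hq : Measurable q)
    (h0 : ∀ w, 0 ≤ q w) (h1 : ∀ w, q w ≤ 1) :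
    weightedEnergy (fun w => 1 - q w) u + weightedEnergy q u = eLpNorm u 2 volume ^ 2 := by
  rw [← weightedEnergy_one hu]
  unfold weightedEnergy
  have hm : AEMeasurable (fun w => ‖l2Fourier u w‖ₑ ^ 2 * ENNReal.ofReal (q w)) :=
    ((memLp_l2Fourier hu).1.enorm.pow_const 2).mul hq.ennreal_ofReal.aemeasurable
  rw [← lintegral_add_right' _ hm]
  refine lintegral_congr fun w => ?_
  rw [← mul_add, ← ENNReal.ofReal_add (by linarith [h1 w]) (h0 w), sub_add_cancel]

theorem norm_conv_le_norm_conv_modulus (v g : E → ℂ) (h : E → ℝ) (hg : ∀ x, ‖g x‖ = h x) (y : E) :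
    ‖conv v g y‖ ≤ ‖conv (modulus v) (fun x => (h x : ℂ)) y‖ := by
  have e : conv (modulus v) (fun x => (h x : ℂ)) y = ((∫ t, ‖v t * g (y - t)‖ : ℝ) : ℂ) := by
    refine Eq.trans ?_ integral_ofReal
    simp [conv, convolution, hg]
  rw [e, Complex.norm_real, Real.norm_of_nonneg (integral_nonneg fun _ => norm_nonneg _)]
  exact norm_integral_le_integral_norm _

theorem fourier_fourierChar_mul (h : E → ℂ) (ν w : E) :
    𝓕 (fun x => Real.fourierChar (inner ℝ x ν) * h x) w = 𝓕 h (w - ν) := by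
  simp only [Real.fourier_eq, Circle.smul_def, smul_eq_mul]
  refine integral_congr_ae (Filter.Eventually.of_forall fun s => ?_)
  beta_reduce
  rw [← mul_assoc, ← Circle.coe_mul, ← AddChar.map_add_eq_mul, inner_sub_right]
  congr 3
  ring

/-- Taking the modulus of a function does not increase the energy with weight `p`, even
in comparison with all translates of `p`. -/
def ModulusStable (p : E → ℝ) : Prop :=
  ∀ v : E → ℂ, MemLp v 2 volume → ∀ ν : E,
    weightedEnergy p (modulus v) ≤ weightedEnergy (fun w => p (w - ν)) v

theorem modulusStable_one : ModulusStable (fun _ : E => (1 : ℝ)) := by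
  intro v hv ν
  rw [weightedEnergy_one hv, weightedEnergy_one (memLp_modulus hv), eLpNorm_modulus]

/-- Modulating the nonnegative kernel by `ν` translates its transform by `ν` and leaves its absolute
value unchanged. Hence convolution with it is dominated by convolving `|v|` with the unmodulated
kernel; passing to the complementary weights reverses the inequality. -/
theorem modulusStable_one_sub_ballOverlap {R : ℝ} (hR : 0 < R) :
    ModulusStable fun w : E => 1 - ballOverlap (R⁻¹ • w) ^ 2 := by
  intro v hv ν
  obtain ⟨h, hpos, hL1, hL2, hF⟩ := exists_fourier_eq_ballOverlap (E := E) hR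
  set k : E → ℂ := fun x => Real.fourierChar (inner ℝ x ν) * (h x : ℂ) with hk
  have hkF : ∀ w, 𝓕 k w = ballOverlap (R⁻¹ • (w - ν)) := fun w => by
    rw [hk, fourier_fourierChar_mul, hF]
  have hkn : ∀ x, ‖k x‖ = h x := fun x => by
    rw [hk, norm_mul, Circle.norm_coe, one_mul, Complex.norm_real, Real.norm_of_nonneg (hpos x)]
  have hkp : ∀ p, MemLp (fun x => (h x : ℂ)) p → MemLp k p := fun p hp => by
    refine hp.of_le ?_ (Filter.Eventually.of_forall fun x => ?_)
    · refine AEStronglyMeasurable.mul ?_ hp.1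
      refine Continuous.aestronglyMeasurable ?_
      exact continuous_subtype_val.comp (Real.continuous_fourierChar.comp (by fun_prop))
    · rw [hkn, Complex.norm_real]
      exact le_abs_self _
  have hm : Measurable fun w : E => ballOverlap (R⁻¹ • w) := measurable_ballOverlap hR
  have hq0 : ∀ w : E, 0 ≤ ballOverlap (R⁻¹ • w) ^ 2 := fun w => sq_nonneg _
  have hq1 : ∀ w : E, ballOverlap (R⁻¹ • w) ^ 2 ≤ 1 := fun w =>
    pow_le_one₀ (ballOverlap_nonneg _) (ballOverlap_le_one _)
  have he : ∀ x : E, ENNReal.ofReal (ballOverlap x ^ 2) = ‖(ballOverlap x : ℂ)‖ₑ ^ 2 := fun x => by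
    rw [← ofReal_norm, Complex.norm_real, Real.norm_of_nonneg (ballOverlap_nonneg x),
      ENNReal.ofReal_pow (ballOverlap_nonneg x)]
  have hA := weightedEnergy_one_sub_add (memLp_modulus hv) (hm.pow_const 2) hq0 hq1
  have hB := weightedEnergy_one_sub_add hv ((hm.comp (measurable_sub_const ν)).pow_const 2)
    (fun w => hq0 (w - ν)) (fun w => hq1 (w - ν))
  have hle : weightedEnergy (fun w => ballOverlap (R⁻¹ • (w - ν)) ^ 2) v ≤
      weightedEnergy (fun w => ballOverlap (R⁻¹ • w) ^ 2) (modulus v) := by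
    have e1 : weightedEnergy (fun w => ballOverlap (R⁻¹ • (w - ν)) ^ 2) v =
        eLpNorm (conv v k) 2 volume ^ 2 := by
      rw [eLpNorm_conv_sq hv (hkp 1 hL1) (hkp 2 hL2)]
      simp only [weightedEnergy, hkF, he]
    have e2 : weightedEnergy (fun w => ballOverlap (R⁻¹ • w) ^ 2) (modulus v) =
        eLpNorm (conv (modulus v) fun x => (h x : ℂ)) 2 volume ^ 2 := by
      rw [eLpNorm_conv_sq (memLp_modulus hv) hL1 hL2]
      simp only [weightedEnergy, hF, he]
    rw [e1, e2]
    exact pow_le_pow_left' (eLpNorm_mono (norm_conv_le_norm_conv_modulus v k h hkn)) 2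
  rw [eLpNorm_modulus, ← hB] at hA
  -- Finiteness allows cancelling this term in `[0, ∞]`.
  have hfin : weightedEnergy (fun w => ballOverlap (R⁻¹ • w) ^ 2) (modulus v) ≠ ⊤ := by
    refine ne_top_of_le_ne_top (ENNReal.pow_ne_top (n := 2) hv.2.ne) ?_
    rw [← hB, ← hA]
    exact le_add_self
  refine (ENNReal.add_le_add_iff_right hfin).1 ?_
  rw [hA]
  exact add_le_add le_rfl hle

/-- One layer of the network decreases the weighted energy, provided that on the support of each
filter a translate of the weight `p` is dominated by the weight `p'`. -/
theorem tsum_weightedEnergy_le {Λ : Type*} {Ψ : FilterBank E Λ} (hΨ : Ψ.InL1L2)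
    (hF : Ψ.FrameCondition 1 1) {p p' : E → ℝ} (hp : ModulusStable p) (hm : Measurable p')
    (h0 : ∀ w, 0 ≤ p' w) (h1 : ∀ w, p' w ≤ 1)
    (hsupp : ∀ lam, ∃ ν, ∀ᵐ w, 𝓕 (Ψ.g lam) w ≠ 0 → p (w - ν) ≤ p' w)
    {u : E → ℂ} (hu : MemLp u 2) :
    ∑' lam, weightedEnergy p (modulus (conv u (Ψ.g lam))) ≤ weightedEnergy p' u := by
  -- The Parseval bound will be applied to the function `v` with transform `√p' · û`, whose total
  -- energy is the `p'`-energy of `u`.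
  have hFm : MemLp (fun w => (Real.sqrt (p' w) : ℂ) * l2Fourier u w) 2 := by
    refine (memLp_l2Fourier hu).of_le ?_ (Filter.Eventually.of_forall fun w => ?_)
    · exact (Complex.measurable_ofReal.comp hm.sqrt).aestronglyMeasurable.mul
        (memLp_l2Fourier hu).1
    · rw [norm_mul, Complex.norm_real, Real.norm_of_nonneg (Real.sqrt_nonneg _)]
      exact mul_le_of_le_one_left (norm_nonneg _) (Real.sqrt_le_one.2 (h1 w))
  obtain ⟨v, hv, hvF⟩ := exists_l2Fourier_ae_eq hFm
  have hsq : ∀ w, ‖(Real.sqrt (p' w) : ℂ) * l2Fourier u w‖ₑ ^ 2 =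
      ‖l2Fourier u w‖ₑ ^ 2 * ENNReal.ofReal (p' w) := fun w => by
    rw [enorm_mul, mul_pow, mul_comm, ← ofReal_norm (Real.sqrt (p' w) : ℂ), Complex.norm_real,
      Real.norm_of_nonneg (Real.sqrt_nonneg _), ← ENNReal.ofReal_pow (Real.sqrt_nonneg _),
      Real.sq_sqrt (h0 w)]
  have hterm : ∀ lam, weightedEnergy p (modulus (conv u (Ψ.g lam))) ≤
      eLpNorm (conv v (Ψ.g lam)) 2 volume ^ 2 := by
    intro lam
    obtain ⟨hg1, hg2⟩ := hΨ.2 lam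
    obtain ⟨ν, hν⟩ := hsupp lam
    refine (hp _ (memLp_conv hu hg1 hg2) ν).trans ?_
    rw [eLpNorm_conv_sq hv hg1 hg2]
    refine lintegral_mono_ae ?_
    filter_upwards [hν, l2Fourier_conv hu hg1 hg2, hvF] with w hw hc hvw
    rw [hc, hvw, hsq]
    rcases eq_or_ne (𝓕 (Ψ.g lam) w) 0 with hz | hz
    · simp [hz]
    · rw [enorm_mul, mul_pow, mul_right_comm]
      gcongr
      exact hw hz
  calc ∑' lam, weightedEnergy p (modulus (conv u (Ψ.g lam)))
      ≤ ∑' lam, eLpNorm (conv v (Ψ.g lam)) 2 volume ^ 2 := ENNReal.tsum_le_tsum hterm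
    _ ≤ eLpNorm v 2 volume ^ 2 := by
        have := (hF v hv).2
        rw [ENNReal.ofReal_one, one_mul] at this
        exact le_add_self.trans this
    _ = weightedEnergy p' u := by
        rw [← eLpNorm_l2Fourier hv, ← lintegral_enorm_sq]
        refine lintegral_congr_ae ?_
        filter_upwards [hvF] with w hw
        rw [hw, hsq]

/-! ### Propagation of energy through the layers -/

section Network

variable {Λ : ℕ → Type*} {Ω : ∀ n, FilterBank E (Λ n)}

theorem memLp_featureMap (hΩ : ∀ n, (Ω n).InL1L2) {f : E → ℂ} (hf : MemLp f 2) :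
    ∀ n (q : Path Λ n), MemLp (featureMap Ω f n q) 2
  | 0, _ => hf
  | n + 1, q => memLp_modulus
      (memLp_conv (memLp_featureMap hΩ hf n q.1) ((hΩ n).2 q.2).1 ((hΩ n).2 q.2).2)

theorem featureMap_succ (f : E → ℂ) (n : ℕ) (q : Path Λ n × Λ n) :
    featureMap Ω f (n + 1) q = modulus (conv (featureMap Ω f n q.1) ((Ω n).g q.2)) := rfl

theorem tsum_path_zero (a : Path Λ 0 → ENNReal) : ∑' q, a q = a PUnit.unit :=
  tsum_eq_single (β := Path Λ 0) PUnit.unit fun _ hb => (hb rfl).elim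

theorem tsum_path_succ (n : ℕ) (a : Path Λ (n + 1) → ENNReal) :
    ∑' q, a q = ∑' q : Path Λ n, ∑' lam : Λ n, a (q, lam) :=
  ENNReal.tsum_prod' (f := a)

theorem sum_featureEnergy_add (hΩ : ∀ n, (Ω n).InL1L2) (hF : ∀ n, (Ω n).FrameCondition 1 1)
    {f : E → ℂ} (hf : MemLp f 2) (M : ℕ) :
    ∑ n ∈ Finset.range M, featureEnergy Ω f n +
      ∑' q : Path Λ M, eLpNorm (featureMap Ω f M q) 2 volume ^ 2 = eLpNorm f 2 volume ^ 2 := by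
  induction M with
  | zero => rw [tsum_path_zero, Finset.range_zero, Finset.sum_empty, zero_add]; rfl
  | succ M ih =>
    rw [← ih, Finset.sum_range_succ, add_assoc, tsum_path_succ, featureEnergy, ← ENNReal.tsum_add]
    congr 2
    ext q
    have h := hF M _ (memLp_featureMap hΩ hf M q)
    simp only [ENNReal.ofReal_one, one_mul] at h
    simp only [featureMap_succ, eLpNorm_modulus]
    exact le_antisymm h.2 h.1

/-- The index `k` counts the layers still to be crossed before depth `M`. Moving one layer towards
the input replaces `p k` by `p (k + 1)`. -/
theorem tsum_eLpNorm_featureMap_le (hΩ : ∀ n, (Ω n).InL1L2) (hF : ∀ n, (Ω n).FrameCondition 1 1)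
    {p : ℕ → E → ℝ} (hp0 : p 0 = fun _ => 1) (hp : ∀ k, ModulusStable (p k))
    (hm : ∀ k, Measurable (p k)) (h0 : ∀ k w, 0 ≤ p k w) (h1 : ∀ k w, p k w ≤ 1)
    (hsupp : ∀ n k lam, ∃ ν, ∀ᵐ w, 𝓕 ((Ω n).g lam) w ≠ 0 → p k (w - ν) ≤ p (k + 1) w)
    {f : E → ℂ} (hf : MemLp f 2) (k : ℕ) : ∀ m M : ℕ, m + k = M →
    ∑' q : Path Λ M, eLpNorm (featureMap Ω f M q) 2 volume ^ 2 ≤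
      ∑' q : Path Λ m, weightedEnergy (p k) (featureMap Ω f m q) := by
  induction k with
  | zero =>
    intro m M hM
    obtain rfl : m = M := hM
    refine ENNReal.tsum_le_tsum fun q => ?_
    rw [hp0, weightedEnergy_one (memLp_featureMap hΩ hf m q)]
  | succ k ih =>
    intro m M hM
    refine (ih (m + 1) M (by omega)).trans ?_
    rw [tsum_path_succ]
    simp only [featureMap_succ]
    refine ENNReal.tsum_le_tsum fun q => ?_
    have hq := memLp_featureMap hΩ hf m q
    exact tsum_weightedEnergy_le (hΩ m) (hF m) (hp k) (hm (k + 1)) (h0 (k + 1)) (h1 (k + 1))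
      (hsupp m k) hq

theorem capturesEnergy_of_weights (hΩ : ∀ n, (Ω n).InL1L2) (hF : ∀ n, (Ω n).FrameCondition 1 1)
    {p : ℕ → E → ℝ} (hp0 : p 0 = fun _ => 1) (hp : ∀ k, ModulusStable (p k))
    (hm : ∀ k, Measurable (p k)) (h0 : ∀ k w, 0 ≤ p k w) (h1 : ∀ k w, p k w ≤ 1)
    (hsupp : ∀ n k lam, ∃ ν, ∀ᵐ w, 𝓕 ((Ω n).g lam) w ≠ 0 → p k (w - ν) ≤ p (k + 1) w)
    {f : Lp (α := E) ℂ 2 volume} (hf0 : f ≠ 0) {ε : ℝ} (hε0 : 0 ≤ ε) (hε : ε ≤ 1) {N : ℕ}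
    (hfN : ∀ᵐ w, (𝓕 f : Lp (α := E) ℂ 2 volume) w ≠ 0 → p (N + 1) w ≤ ε) :
    CapturesEnergy Ω f ε N := by
  have hf : MemLp f 2 := Lp.memLp f
  have hsum := sum_featureEnergy_add hΩ hF hf (N + 1)
  -- Features of layers `0, …, N` leave the paths of length `N + 1`, so the weight reaching the
  -- input is `p (N + 1)`.
  have htail := tsum_eLpNorm_featureMap_le hΩ hF hp0 hp hm h0 h1 hsupp hf (N + 1) 0 _ (zero_add _)
  rw [tsum_path_zero] at htail
  have hle : weightedEnergy (p (N + 1)) f ≤ ENNReal.ofReal ε * eLpNorm f 2 volume ^ 2 := by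
    rw [← weightedEnergy_one hf, weightedEnergy, weightedEnergy,
      ← lintegral_const_mul' _ _ ENNReal.ofReal_ne_top]
    refine lintegral_mono_ae ?_
    filter_upwards [hfN] with w hw
    rw [l2Fourier_eq hf, Lp.toLp_coeFn, ENNReal.ofReal_one, mul_one, mul_comm]
    rcases eq_or_ne ((𝓕 f : Lp (α := E) ℂ 2 volume) w) 0 with hz | hz
    · simp [hz]
    · gcongr
      exact hw hz
  have hne : eLpNorm f 2 volume ^ 2 ≠ 0 := by
    refine pow_ne_zero 2 fun h => hf0 ?_
    rw [eLpNorm_eq_zero_iff hf.1 (by norm_num)] at h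
    exact (Lp.eq_zero_iff_ae_eq_zero).2 h
  have hfin : eLpNorm f 2 volume ^ 2 ≠ ⊤ := ENNReal.pow_ne_top hf.2.ne
  set S := ∑ n ∈ Finset.range (N + 1), featureEnergy Ω f n
  set T := ∑' q : Path Λ (N + 1), eLpNorm (featureMap Ω f (N + 1) q) 2 volume ^ 2
  set X := eLpNorm f 2 volume ^ 2
  have hT : T ≤ ENNReal.ofReal ε * X := htail.trans hle
  refine ⟨?_, ?_⟩
  · rw [ENNReal.le_div_iff_mul_le (Or.inl hne) (Or.inl hfin)]
    have hTfin : T ≠ ⊤ := ne_top_of_le_ne_top (ENNReal.mul_ne_top ENNReal.ofReal_ne_top hfin) hT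
    refine (ENNReal.add_le_add_iff_right hTfin).1 ?_
    rw [hsum]
    calc ENNReal.ofReal (1 - ε) * X + T ≤ ENNReal.ofReal (1 - ε) * X + ENNReal.ofReal ε * X :=
          add_le_add le_rfl hT
      _ = X := by
        rw [← add_mul, ← ENNReal.ofReal_add (by linarith) hε0, sub_add_cancel, ENNReal.ofReal_one,
          one_mul]
  · refine ENNReal.div_le_of_le_mul ?_
    rw [one_mul]
    change S ≤ X
    rw [← hsum]
    exact le_self_add

end Network

end Energy

/-! ### Weights built from a sequence of radii -/

section Radii

variable {E : Type*} [NormedAddCommGroup E] [InnerProductSpace ℝ E] [FiniteDimensional ℝ E]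
  [MeasurableSpace E] [BorelSpace E]

/-- The weights `1 - ballOverlap (w / R_k)²`, preceded by the constant weight `1`. -/
def overlapWeight (R : ℕ → ℝ) : ℕ → E → ℝ
  | 0 => fun _ => 1
  | k + 1 => fun w => 1 - ballOverlap ((R k)⁻¹ • w) ^ 2

theorem overlapWeight_nonneg (R : ℕ → ℝ) (k : ℕ) (w : E) : 0 ≤ overlapWeight R k w := by
  cases k with
  | zero => exact zero_le_one
  | succ k => exact sub_nonneg.2 (pow_le_one₀ (ballOverlap_nonneg _) (ballOverlap_le_one _))

theorem overlapWeight_le_one (R : ℕ → ℝ) (k : ℕ) (w : E) : overlapWeight R k w ≤ 1 := by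
  cases k with
  | zero => exact le_rfl
  | succ k => exact sub_le_self _ (sq_nonneg _)

theorem overlapWeight_eq_one {R : ℕ → ℝ} {k : ℕ} (hR : 0 < R k) {w : E} (hw : R k ≤ ‖w‖) :
    overlapWeight R (k + 1) w = 1 := by
  have h : 1 ≤ ‖(R k)⁻¹ • w‖ := by
    rw [norm_smul, norm_inv, Real.norm_of_nonneg hR.le, inv_mul_eq_div, one_le_div hR]
    exact hw
  simp [overlapWeight, ballOverlap_eq_zero h]

theorem measurable_overlapWeight {R : ℕ → ℝ} (hR : ∀ k, 0 < R k) (k : ℕ) :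
    Measurable (overlapWeight R k : E → ℝ) := by
  cases k with
  | zero => exact measurable_const
  | succ k => exact ((measurable_ballOverlap (hR k)).pow_const 2).const_sub 1

theorem modulusStable_overlapWeight {R : ℕ → ℝ} (hR : ∀ k, 0 < R k) (k : ℕ) :
    ModulusStable (overlapWeight R k : E → ℝ) := by
  cases k with
  | zero => exact modulusStable_one
  | succ k => exact modulusStable_one_sub_ballOverlap (hR k)

/-- The weight contains the square of the overlap, so the lower bound has exponent `2 * l`; this is
the source of `1 / (2 * l)` in the radius. -/
theorem one_sub_le_ballOverlap_sq {l : ℝ} (hl : 0 < l)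
    (hov : ∀ w : E, ‖w‖ < 1 → (1 - ‖w‖) ^ l ≤ ballOverlap w) {ε : ℝ} (hε1 : ε < 1)
    {w : E} (hw : ‖w‖ ≤ 1 - (1 - ε) ^ (1 / (2 * l))) : 1 - ε ≤ ballOverlap w ^ 2 := by
  set c := (1 - ε) ^ (1 / (2 * l)) with hc
  have hc0 : 0 < c := Real.rpow_pos_of_pos (by linarith) _
  have h1 : c ^ l ≤ ballOverlap w :=
    (Real.rpow_le_rpow hc0.le (by linarith) hl.le).trans (hov w (by linarith))
  have h2 : (c ^ l) ^ 2 = 1 - ε := by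
    rw [← Real.rpow_natCast, ← Real.rpow_mul hc0.le, hc, ← Real.rpow_mul (by linarith)]
    have : 1 / (2 * l) * (l * (2 : ℕ)) = 1 := by
      push_cast
      field_simp
    rw [this, Real.rpow_one]
  rw [← h2]
  exact pow_le_pow_left₀ (by positivity) h1 2

/-- Energy capture for networks whose filters avoid the ball of radius `R 0`, and whose frequency
supports can be shifted towards the origin in such a way that `‖w‖` shrinks by
the factor `R k / R (k + 1)`. -/
theorem capturesEnergy_of_radii {Λ : ℕ → Type*} {Ω : ∀ n, FilterBank E (Λ n)}
    (hΩ : ∀ n, (Ω n).InL1L2) (hF : ∀ n, (Ω n).FrameCondition 1 1)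
    {R : ℕ → ℝ} (hR : ∀ k, 0 < R k)
    (hgap : ∀ n lam, ∀ᵐ w, 𝓕 ((Ω n).g lam) w ≠ 0 → R 0 ≤ ‖w‖)
    (hshift : ∀ n k lam, ∃ ν, ∀ w, 𝓕 ((Ω n).g lam) w ≠ 0 → R 0 ≤ ‖w‖ → ‖w‖ ≤ R (k + 1) →
      R (k + 1) * ‖w - ν‖ ≤ R k * ‖w‖)
    {l : ℝ} (hl : 0 < l) (hov : ∀ w : E, ‖w‖ < 1 → (1 - ‖w‖) ^ l ≤ ballOverlap w)
    {ε : ℝ} (hε0 : 0 < ε) (hε1 : ε < 1) {L : ℝ}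
    {f : Lp (α := E) ℂ 2 volume} (hf0 : f ≠ 0) (hfL : BandLimited f L) {N : ℕ}
    (hN : L ≤ R N * (1 - (1 - ε) ^ (1 / (2 * l)))) : CapturesEnergy Ω f ε N := by
  refine capturesEnergy_of_weights hΩ hF (p := overlapWeight R) rfl
    (modulusStable_overlapWeight hR) (measurable_overlapWeight hR) (overlapWeight_nonneg R)
    (overlapWeight_le_one R) (fun n k lam => ?_) hf0 hε0.le hε1.le ?_
  · cases k with
    | zero =>
      -- No shift is needed here: the first overlap weight already equals `1` outside the spectral
      -- gap.
      refine ⟨0, ?_⟩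
      filter_upwards [hgap n lam] with w hw hne
      rw [overlapWeight_eq_one (hR 0) (hw hne)]
      exact le_rfl
    | succ k =>
      obtain ⟨ν, hν⟩ := hshift n k lam
      refine ⟨ν, ?_⟩
      filter_upwards [hgap n lam] with w hw hne
      -- Beyond radius `R (k + 1)` the target weight is `1`; only frequencies inside need the shift.
      rcases le_total (R (k + 1)) ‖w‖ with h | h
      · rw [overlapWeight_eq_one (hR (k + 1)) h]
        exact overlapWeight_le_one R _ _
      · have hle := hν w hne (hw hne) h
        refine sub_le_sub_left (pow_le_pow_left₀ (ballOverlap_nonneg _) (ballOverlap_anti ?_) 2) 1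
        rw [norm_smul, norm_smul, norm_inv, norm_inv, Real.norm_of_nonneg (hR k).le,
          Real.norm_of_nonneg (hR (k + 1)).le, inv_mul_eq_div, inv_mul_eq_div,
          div_le_div_iff₀ (hR k) (hR (k + 1))]
        linarith
  · filter_upwards [hfL] with w hw hne
    have hwL : ‖w‖ < L := by
      by_contra h
      exact hne (hw (by simpa using h))
    have h := one_sub_le_ballOverlap_sq hl hov hε1 (w := (R N)⁻¹ • w) (by
      rw [norm_smul, norm_inv, Real.norm_of_nonneg (hR N).le, inv_mul_le_iff₀ (hR N)]
      exact hwL.le.trans hN)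
    change 1 - ballOverlap ((R N)⁻¹ • w) ^ 2 ≤ ε
    linarith

end Radii

/-! ### Numerical inequalities behind the growth rates -/

section Numeric

theorem one_sub_rpow_pos {ε l : ℝ} (hε0 : 0 < ε) (hε1 : ε < 1) (hl : 0 < l) :
    0 < 1 - (1 - ε) ^ (1 / (2 * l)) :=
  sub_pos.2 (Real.rpow_lt_one (by linarith) (by linarith) (by positivity))

theorem le_pow_of_ceil_logb_le {a X : ℝ} (ha : 1 < a) {N : ℕ} (h : ⌈Real.logb a X⌉ ≤ (N : ℤ)) :
    X ≤ a ^ N := by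
  rcases le_or_gt X 0 with hX | hX
  · exact hX.trans (by positivity)
  · have h1 : Real.logb a X ≤ N := by exact_mod_cast Int.ceil_le.1 h
    rw [Real.logb_le_iff_le_rpow ha hX] at h1
    exact_mod_cast h1

theorem two_rpow_decayExponent_sq {d : ℕ} (hd : 2 ≤ d) :
    ((2 : ℝ) ^ decayExponent d) ^ 2 = d / (d - 1 / 2) := by
  have hd' : (2 : ℝ) ≤ d := by exact_mod_cast hd
  have hpos : 0 < (d : ℝ) / (d - 1 / 2) := div_pos (by linarith) (by linarith)
  rw [decayExponent, if_neg (by omega), Real.rpow_logb (by norm_num) (by norm_num)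
    (Real.sqrt_pos.2 hpos), Real.sq_sqrt hpos.le]

theorem decayExponent_pos {d : ℕ} (hd : 1 ≤ d) : 0 < decayExponent d := by
  rcases eq_or_ne d 1 with rfl | h1
  · simp [decayExponent]
  · have hd' : (2 : ℝ) ≤ d := by exact_mod_cast (by omega : 2 ≤ d)
    rw [decayExponent, if_neg h1]
    refine Real.logb_pos (by norm_num) (Real.lt_sqrt_of_sq_lt ?_)
    rw [lt_div_iff₀ (by linarith)]
    linarith

theorem two_rpow_decayExponent_le {d : ℕ} (hd : 2 ≤ d) : (2 : ℝ) ^ decayExponent d ≤ 3 / 2 := by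
  have hd' : (2 : ℝ) ≤ d := by exact_mod_cast hd
  refine le_of_sq_le_sq ?_ (by norm_num)
  rw [two_rpow_decayExponent_sq hd, div_le_iff₀ (by linarith)]
  linarith

/-- This makes `t ^ (2α)` concave, as the chord bound requires. -/
theorem two_mul_decayExponent_le_one {d : ℕ} (hd : 2 ≤ d) : 2 * decayExponent d ≤ 1 := by
  have hd' : (2 : ℝ) ≤ d := by exact_mod_cast hd
  have h : (2 : ℝ) ^ (2 * decayExponent d) ≤ 2 ^ (1 : ℝ) := by
    rw [mul_comm, Real.rpow_mul (by norm_num), Real.rpow_one, Real.rpow_two,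
      two_rpow_decayExponent_sq hd, div_le_iff₀ (by linarith)]
    linarith
  exact (Real.rpow_le_rpow_left_iff (by norm_num)).1 h

/-- By concavity, `t ^ (2 α)` lies above its chord over `[1/2, 1]`. -/
theorem le_rpow_decayExponent_sq {d : ℕ} (hd : 2 ≤ d) {t : ℝ} (ht : 1 / 2 ≤ t) (ht1 : t ≤ 1) :
    1 - (1 - t) / d ≤ (t ^ decayExponent d) ^ 2 := by
  have hd' : (2 : ℝ) ≤ d := by exact_mod_cast hd
  have hα := decayExponent_pos (by omega : 1 ≤ d)
  have hc := (Real.concaveOn_rpow (p := 2 * decayExponent d) (by linarith)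
    (two_mul_decayExponent_le_one hd)).2 (Set.mem_Ici.2 zero_le_one)
    (Set.mem_Ici.2 (by norm_num : (0 : ℝ) ≤ 1 / 2)) (by linarith : 0 ≤ 2 * t - 1)
    (by linarith : 0 ≤ 2 * (1 - t)) (by ring)
  have e1 : (2 * t - 1) • (1 : ℝ) + (2 * (1 - t)) • (1 / 2 : ℝ) = t := by
    simp only [smul_eq_mul]
    ring
  -- The exponent is calibrated so that the chord from `1/2` to `1` has slope exactly `1/d`.
  have e2 : (1 / 2 : ℝ) ^ (2 * decayExponent d) = 1 - 1 / (2 * d) := by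
    rw [mul_comm, Real.rpow_mul (by norm_num), Real.rpow_two, one_div, Real.inv_rpow (by norm_num),
      inv_pow, two_rpow_decayExponent_sq hd]
    field_simp
  have e3 : t ^ (2 * decayExponent d) = (t ^ decayExponent d) ^ 2 := by
    rw [mul_comm, Real.rpow_mul (by linarith), Real.rpow_two]
  rw [e1] at hc
  beta_reduce at hc
  rw [e2, e3, Real.one_rpow] at hc
  refine le_trans (le_of_eq ?_) hc
  simp only [smul_eq_mul]
  field_simp
  ring

/-- The number `c` is the common coordinate of a diagonal shift. For `x` in the orthant with `‖x‖ =
y`, the quadratic in `y` bounds the squared norm after the shift, since `∑ xᵢ ≥ ‖x‖`. One `c` serves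
every `k`. -/
theorem exists_shift_bound {d : ℕ} (hd : 1 ≤ d) {δ : ℝ} (hδ : 0 < δ) :
    ∃ c : ℝ, 0 ≤ c ∧ ∀ (k : ℕ) (y : ℝ), δ ≤ y → y ≤ ((k : ℝ) + 2) ^ decayExponent d * δ →
      (((k : ℝ) + 2) ^ decayExponent d) ^ 2 * (y ^ 2 - 2 * c * y + d * c ^ 2) ≤
        (((k : ℝ) + 1) ^ decayExponent d) ^ 2 * y ^ 2 := by
  rcases eq_or_ne d 1 with rfl | h1
  · refine ⟨δ, hδ.le, fun k y hy1 hy2 => ?_⟩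
    simp only [decayExponent, if_true, Real.rpow_one] at hy2 ⊢
    have h : ((k : ℝ) + 2) * (y - δ) ≤ (k + 1) * y := by linarith
    have h' : 0 ≤ ((k : ℝ) + 2) * (y - δ) := mul_nonneg (by positivity) (by linarith)
    have := pow_le_pow_left₀ h' h 2
    push_cast
    nlinarith
  · have hd2 : 2 ≤ d := by omega
    have hd' : (2 : ℝ) ≤ d := by exact_mod_cast hd2
    have hα := decayExponent_pos hd
    -- This shift lowers the squared norm by at least `(δy - δ²/4)/d ≥ 3δy/(4d)`, because `y ≥ δ`.
    -- The chord bound asks for a drop of `y²/(d(k + 2))`, which is affordable because `y ≤ (3/4)(k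
    -- + 2)δ`.
    refine ⟨δ / (2 * d), by positivity, fun k y hy1 hy2 => ?_⟩
    have hk : (0 : ℝ) < k + 2 := by positivity
    set P := ((k : ℝ) + 2) ^ decayExponent d with hP
    set Q := ((k : ℝ) + 1) ^ decayExponent d
    have hPpos : 0 < P := Real.rpow_pos_of_pos hk _
    -- Factoring out `2^α ≤ 3/2` gains the constant `3/4` over the trivial bound `k + 2`.
    have hPle : P ≤ 3 / 4 * (k + 2) := by
      have e : P = 2 ^ decayExponent d * (((k : ℝ) + 2) / 2) ^ decayExponent d := by
        rw [← Real.mul_rpow (by norm_num) (by positivity), mul_div_cancel₀ _ (by norm_num)]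
      have h2 : (((k : ℝ) + 2) / 2) ^ decayExponent d ≤ ((k : ℝ) + 2) / 2 := by
        conv_rhs => rw [← Real.rpow_one (((k : ℝ) + 2) / 2)]
        refine Real.rpow_le_rpow_of_exponent_le ?_ (by linarith [two_mul_decayExponent_le_one hd2])
        have : (0 : ℝ) ≤ k := by positivity
        linarith
      rw [e]
      calc _ ≤ 3 / 2 * (((k : ℝ) + 2) / 2) :=
            mul_le_mul (two_rpow_decayExponent_le hd2) h2 (by positivity) (by norm_num)
        _ = _ := by ring
    have hchord : P ^ 2 * (1 - 1 / (d * (k + 2))) ≤ Q ^ 2 := by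
      have h := le_rpow_decayExponent_sq hd2 (t := ((k : ℝ) + 1) / (k + 2))
        (by rw [div_le_div_iff₀ (by norm_num) hk]; linarith [(Nat.cast_nonneg k : (0 : ℝ) ≤ k)])
        (by rw [div_le_one hk]; linarith)
      rw [Real.div_rpow (by positivity) hk.le, div_pow, le_div_iff₀ (by positivity)] at h
      refine le_trans (le_of_eq ?_) h
      rw [← hP, mul_comm]
      congr 1
      field_simp
      ring
    have hy : y ≤ 3 / 4 * (k + 2) * δ := hy2.trans (mul_le_mul_of_nonneg_right hPle hδ.le)
    have hy0 : 0 < y := by linarith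
    have hdk : y ^ 2 / (d * (k + 2)) ≤ (3 / 4 * δ * y) / d := by
      rw [div_le_div_iff₀ (by positivity) (by positivity)]
      nlinarith [mul_le_mul_of_nonneg_left hy (by positivity : 0 ≤ y * d)]
    have hc : (3 / 4 * δ * y) / d ≤ 2 * (δ / (2 * d)) * y - d * (δ / (2 * d)) ^ 2 := by
      have e : 2 * (δ / (2 * d)) * y - d * (δ / (2 * d)) ^ 2 = (δ * y - δ ^ 2 / 4) / d := by
        field_simp
        ring
      rw [e]
      refine div_le_div_of_nonneg_right ?_ (by positivity)
      nlinarith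
    calc P ^ 2 * (y ^ 2 - 2 * (δ / (2 * d)) * y + d * (δ / (2 * d)) ^ 2)
        ≤ P ^ 2 * (y ^ 2 - y ^ 2 / (d * (k + 2))) :=
          mul_le_mul_of_nonneg_left (by linarith) (by positivity)
      _ = P ^ 2 * (1 - 1 / (d * (k + 2))) * y ^ 2 := by ring
      _ ≤ Q ^ 2 * y ^ 2 := mul_le_mul_of_nonneg_right hchord (by positivity)

end Numeric

/-! ### Filters supported in rotated orthants -/

section Orthant

theorem norm_le_sum_of_mem_orthant {d : ℕ} {x : EuclideanSpace ℝ (Fin d)} (hx : x ∈ orthant d) :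
    ‖x‖ ≤ ∑ i, x i := by
  have h0 : 0 ≤ ∑ i, x i := Finset.sum_nonneg fun i _ => hx i
  refine le_of_sq_le_sq ?_ h0
  rw [EuclideanSpace.real_norm_sq_eq]
  exact Finset.sum_sq_le_sq_sum_of_nonneg fun i _ => hx i

theorem norm_sub_const_sq {d : ℕ} (x : EuclideanSpace ℝ (Fin d)) (c : ℝ) :
    ‖x - WithLp.toLp 2 (fun _ => c)‖ ^ 2 = ‖x‖ ^ 2 - 2 * c * ∑ i, x i + d * c ^ 2 := by
  rw [EuclideanSpace.real_norm_sq_eq, EuclideanSpace.real_norm_sq_eq, Finset.mul_sum,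
    ← Finset.sum_sub_distrib]
  have : (d : ℝ) * c ^ 2 = ∑ _i : Fin d, c ^ 2 := by simp
  rw [this, ← Finset.sum_add_distrib]
  refine Finset.sum_congr rfl fun i _ => ?_
  simp only [PiLp.sub_apply]
  ring

theorem capturesEnergy_of_orthantSupported {d : ℕ} (hd : 1 ≤ d) {Λ : ℕ → Type*}
    {Ω : ∀ n, FilterBank (EuclideanSpace ℝ (Fin d)) (Λ n)}
    (hΩ : ∀ n, (Ω n).InL1L2) (hF : ∀ n, (Ω n).FrameCondition 1 1) (hO : OrthantSupported Ω)
    {δ : ℝ} (hδ : 0 < δ) (hgap : SpectralGap Ω δ) {l : ℝ} (hl : ((d / 2 : ℕ) : ℝ) + 1 < l)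
    {ε : ℝ} (hε0 : 0 < ε) (hε1 : ε < 1) {L : ℝ} (hL : 0 ≤ L)
    {f : Lp (α := EuclideanSpace ℝ (Fin d)) ℂ 2 volume} (hf0 : f ≠ 0) (hfL : BandLimited f L)
    {N : ℕ} (hN : ⌈(L / ((1 - (1 - ε) ^ (1 / (2 * l))) * δ)) ^ (1 / decayExponent d) - 1⌉ ≤
      (N : ℤ)) : CapturesEnergy Ω f ε N := by
  have hl0 : 0 < l := by
    have : (0 : ℝ) ≤ ((d / 2 : ℕ) : ℝ) := Nat.cast_nonneg _
    linarith
  have hα := decayExponent_pos hd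
  have hc := one_sub_rpow_pos hε0 hε1 hl0
  obtain ⟨c, hc0, hcb⟩ := exists_shift_bound hd hδ
  have hRpos : ∀ k : ℕ, 0 < ((k : ℝ) + 1) ^ decayExponent d * δ := fun k => by positivity
  refine capturesEnergy_of_radii hΩ hF (R := fun k => ((k : ℝ) + 1) ^ decayExponent d * δ) hRpos
    (fun n lam => ?_) (fun n k lam => ?_) hl0 (fun w hw => rpow_le_ballOverlap hd hl.le hw)
    hε0 hε1 hf0 hfL ?_
  · filter_upwards [hgap n] with w hw hne
    simp only [Nat.cast_zero, zero_add, Real.one_rpow, one_mul]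
    by_contra h
    have h0 := ENNReal.tsum_eq_zero.1 (hw (by simpa using h)) lam
    exact hne (by simpa using h0)
  · obtain ⟨A, hA⟩ := hO n lam
    -- The shift points along the diagonal of the rotated orthant; applying `A⁻¹` reduces to the
    -- standard orthant.
    refine ⟨A (WithLp.toLp 2 fun _ => c), fun w hne hw0 hwk => ?_⟩
    obtain ⟨x, hx, rfl⟩ := hA (subset_tsupport _ hne)
    rw [← map_sub, A.norm_map, A.norm_map] at *
    simp only [Nat.cast_zero, zero_add, Real.one_rpow, one_mul] at hw0
    have hk2 : ((k + 1 : ℕ) : ℝ) + 1 = k + 2 := by push_cast; ring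
    rw [hk2] at hwk ⊢
    have h := hcb k ‖x‖ hw0 hwk
    refine le_of_sq_le_sq ?_ (by positivity)
    rw [mul_pow, mul_pow, mul_pow, mul_pow, norm_sub_const_sq]
    have hs : ‖x‖ ^ 2 - 2 * c * ∑ i, x i + d * c ^ 2 ≤ ‖x‖ ^ 2 - 2 * c * ‖x‖ + d * c ^ 2 := by
      have := mul_le_mul_of_nonneg_left (norm_le_sum_of_mem_orthant hx) (by positivity : 0 ≤ 2 * c)
      linarith
    have h2 := (mul_le_mul_of_nonneg_left hs
      (sq_nonneg (((k : ℝ) + 2) ^ decayExponent d))).trans h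
    nlinarith [mul_le_mul_of_nonneg_left h2 (sq_nonneg δ)]
  · set X := L / ((1 - (1 - ε) ^ (1 / (2 * l))) * δ) with hX
    have hX0 : 0 ≤ X := by positivity
    have h1 : X ^ (1 / decayExponent d) ≤ N + 1 := by
      have : X ^ (1 / decayExponent d) - 1 ≤ N := by exact_mod_cast Int.ceil_le.1 hN
      linarith
    have h2 : X ≤ ((N : ℝ) + 1) ^ decayExponent d := by
      have h := Real.rpow_le_rpow (by positivity) h1 hα.le
      rwa [← Real.rpow_mul hX0, one_div_mul_cancel hα.ne', Real.rpow_one] at h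
    rw [hX, div_le_iff₀ (by positivity)] at h2
    linarith

end Orthant

/-! ### Wavelet and Weyl-Heisenberg filters on the line -/

section Line

theorem tsupport_fourier_mem {ψ : ℝ → ℂ} {s : Set ℝ} (h : tsupport (𝓕 ψ) ⊆ s) {w : ℝ}
    (hw : 𝓕 ψ w ≠ 0) : w ∈ s :=
  h (subset_tsupport _ hw)

theorem memLp_comp_mul_left {ψ : ℝ → ℂ} {p : ENNReal} (h : MemLp ψ p) {s : ℝ} (hs : s ≠ 0) :
    MemLp (fun x => ψ (s * x)) p := by
  have hm : MeasurableEmbedding fun x : ℝ => s * x := (Homeomorph.mulLeft₀ s hs).measurableEmbedding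
  refine (hm.memLp_map_measure_iff (g := ψ)).1 ?_
  rw [Real.map_volume_mul_left hs]
  exact h.smul_measure ENNReal.ofReal_ne_top

/-- Allowing `s < 0` treats the wavelets of positive and negative index together. -/
theorem fourier_dilation (ψ : ℝ → ℂ) {s : ℝ} (hs : s ≠ 0) (w : ℝ) :
    𝓕 (fun x => ((|s| : ℝ) : ℂ) * ψ (s * x)) w = 𝓕 ψ (w / s) := by
  rw [Real.fourier_real_eq, Real.fourier_real_eq]
  have h := Measure.integral_comp_mul_left
    (fun y => Real.fourierChar (-(y * (w / s))) • ψ y) s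
  have e : ∀ x, Real.fourierChar (-(x * w)) • (((|s| : ℝ) : ℂ) * ψ (s * x)) =
      ((|s| : ℝ) : ℂ) * (Real.fourierChar (-(s * x * (w / s))) • ψ (s * x)) := by
    intro x
    have : s * x * (w / s) = x * w := by field_simp
    rw [this, Circle.smul_def, Circle.smul_def, smul_eq_mul, smul_eq_mul]
    ring
  simp only [e]
  rw [integral_const_mul, h, abs_inv, Complex.real_smul, ← mul_assoc, ← Complex.ofReal_mul,
    mul_inv_cancel₀ (abs_ne_zero.2 hs), Complex.ofReal_one, one_mul]

theorem waveletBank_g (φ ψ : ℝ → ℂ) (j : {j : ℤ // j ≠ 0}) :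
    ∃ s : ℝ, 2 ≤ |s| ∧ (waveletBank φ ψ).g j = fun x => ((|s| : ℝ) : ℂ) * ψ (s * x) := by
  have h2 : (2 : ℝ) ≤ 2 ^ j.1.natAbs :=
    le_self_pow₀ (by norm_num) (Int.natAbs_ne_zero.2 j.2)
  have hpos : (0 : ℝ) < 2 ^ j.1.natAbs := by positivity
  by_cases hj : 0 < j.1
  · refine ⟨2 ^ j.1.natAbs, by rwa [abs_of_pos hpos], ?_⟩
    ext x
    simp [waveletBank, hj]
  · refine ⟨-2 ^ j.1.natAbs, by rwa [abs_neg, abs_of_pos hpos], ?_⟩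
    ext x
    simp [waveletBank, hj]

theorem capturesEnergy_wavelet {φ ψ : ℝ → ℂ} (hφ1 : MemLp φ 1) (hφ2 : MemLp φ 2)
    (hψ1 : MemLp ψ 1) (hψ2 : MemLp ψ 2) (hsupp : tsupport (𝓕 ψ) ⊆ Set.Icc (1 / 2) 2)
    (hF : (waveletBank φ ψ).FrameCondition 1 1) {l : ℝ} (hl : 1 < l)
    {ε : ℝ} (hε0 : 0 < ε) (hε1 : ε < 1) {L : ℝ}
    {f : Lp (α := ℝ) ℂ 2 volume} (hf0 : f ≠ 0) (hfL : BandLimited f L) {N : ℕ}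
    (hN : ⌈Real.logb (5 / 3) (L / ((1 - (1 - ε) ^ (1 / (2 * l))) * 1))⌉ ≤ (N : ℤ)) :
    CapturesEnergy (fun _ => waveletBank φ ψ) f ε N := by
  have hl0 : 0 < l := by linarith
  have hc := one_sub_rpow_pos hε0 hε1 hl0
  have hmem : ∀ j, ∃ s : ℝ, 2 ≤ |s| ∧ (∀ p, MemLp ψ p → MemLp ((waveletBank φ ψ).g j) p) ∧
      ∀ w, 𝓕 ((waveletBank φ ψ).g j) w ≠ 0 → ∃ t, 1 / 2 ≤ t ∧ t ≤ 2 ∧ w = s * t := by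
    intro j
    obtain ⟨s, hs, hg⟩ := waveletBank_g φ ψ j
    have hs0 : s ≠ 0 := by
      rintro rfl
      norm_num at hs
    rw [hg]
    refine ⟨s, hs, fun p hp => (memLp_comp_mul_left hp hs0).const_mul _, fun w hw => ?_⟩
    rw [fourier_dilation ψ hs0] at hw
    obtain ⟨h1, h2⟩ := tsupport_fourier_mem hsupp hw
    exact ⟨w / s, h1, h2, (mul_div_cancel₀ w hs0).symm⟩
  choose s hs hp hw using hmem
  refine capturesEnergy_of_radii (R := fun k => (5 / 3 : ℝ) ^ k)
    (fun _ => ⟨⟨hφ1, hφ2⟩, fun j => ⟨hp j 1 hψ1, hp j 2 hψ2⟩⟩) (fun _ => hF)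
    (fun k => by positivity) (fun _ j => Filter.Eventually.of_forall fun w hne => ?_)
    -- On `[1/2, 2]` the best relative bound `|t - c| ≤ θ t` has the harmonic mean `c = 4/5` as
    -- centre and `θ = 3/5`, hence `a = 5/3`.
    (fun _ k j => ⟨s j * (4 / 5), fun w hne _ _ => ?_⟩) hl0
    (fun w hw => rpow_le_ballOverlap_real hl.le hw) hε0 hε1 hf0 hfL ?_
  · obtain ⟨t, h1, h2, rfl⟩ := hw j w hne
    rw [pow_zero, norm_mul, Real.norm_eq_abs, Real.norm_of_nonneg (by linarith)]
    nlinarith [hs j]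
  · obtain ⟨t, h1, h2, rfl⟩ := hw j w hne
    have h3 : |t - 4 / 5| ≤ 3 / 5 * t := abs_le.2 ⟨by linarith, by linarith⟩
    rw [← mul_sub, norm_mul, norm_mul, Real.norm_eq_abs (t - 4 / 5),
      Real.norm_of_nonneg (by linarith : 0 ≤ t), pow_succ]
    calc (5 / 3 : ℝ) ^ k * (5 / 3) * (‖s j‖ * |t - 4 / 5|)
        ≤ (5 / 3 : ℝ) ^ k * (5 / 3) * (‖s j‖ * (3 / 5 * t)) := by gcongr
      _ = (5 / 3 : ℝ) ^ k * (‖s j‖ * t) := by ring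
  · have h := le_pow_of_ceil_logb_le (by norm_num) hN
    rw [div_le_iff₀ (by positivity), mul_one] at h
    exact h

theorem weylHeisenbergBank_g (R : ℝ) (φ g : ℝ → ℂ) (k : {k : ℤ // k ≠ 0}) :
    ∃ (σ : ℝ) (n : ℕ), |σ| = 1 ∧ 1 ≤ n ∧ (weylHeisenbergBank R φ g).g k =
      fun x => Real.fourierChar (inner ℝ x (σ * ((n + 1) * R))) * g x := by
  have hn : 1 ≤ k.1.natAbs := Nat.one_le_iff_ne_zero.2 (Int.natAbs_ne_zero.2 k.2)
  by_cases hk : 0 < k.1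
  · refine ⟨1, k.1.natAbs, by simp, hn, ?_⟩
    ext x
    simp only [weylHeisenbergBank, hk, if_true, Real.fourierChar_apply]
    congr 2
    generalize k.1.natAbs = m
    simp
    ring
  · refine ⟨-1, k.1.natAbs, by simp, hn, ?_⟩
    ext x
    simp only [weylHeisenbergBank, hk, if_false, Real.fourierChar_apply]
    congr 2
    generalize k.1.natAbs = m
    simp
    ring

/-- The partition of unity of a Weyl-Heisenberg bank excludes `R ≤ 0`. -/
theorem weylHeisenberg_modulation_pos {R : ℝ} {φ g : ℝ → ℂ} (hφ1 : MemLp φ 1) (hφ2 : MemLp φ 2)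
    (hsupp : tsupport (𝓕 g) ⊆ Set.Icc (-R) R)
    (hsum : ∀ᵐ ω : ℝ, 0 ≤ ω →
      HasSum (fun k : ℕ => ‖𝓕 g (ω - R * (((k : ℝ) + 1) + 1))‖ ^ 2) (1 - ‖𝓕 φ ω‖ ^ 2)) :
    0 < R := by
  by_contra! hR
  have hone : ∀ᵐ ω : ℝ, ω ∈ Set.Ioi (0 : ℝ) → ‖𝓕 φ ω‖ₑ ^ 2 = 1 := by
    filter_upwards [hsum] with ω hω hpos
    have hpos' : 0 < ω := hpos
    -- For `R ≤ 0` and `ω > 0` each argument exceeds `R`, so every term vanishes. Then `|𝓕 φ| = 1`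
    -- almost everywhere on a half-line, contradicting `𝓕 φ ∈ L²`.
    have hz : ∀ k : ℕ, 𝓕 g (ω - R * (((k : ℝ) + 1) + 1)) = 0 := by
      intro k
      by_contra hne
      have h := (tsupport_fourier_mem hsupp hne).2
      have : R * (((k : ℝ) + 1) + 1) ≤ 0 := mul_nonpos_of_nonpos_of_nonneg hR (by positivity)
      nlinarith [mul_nonpos_of_nonpos_of_nonneg hR (Nat.cast_nonneg (α := ℝ) k)]
    have h := hω hpos'.le
    simp only [hz, norm_zero, ne_eq, OfNat.ofNat_ne_zero, not_false_eq_true, zero_pow] at h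
    have h1 : ‖𝓕 φ ω‖ ^ 2 = 1 := by
      have := h.unique hasSum_zero
      linarith
    rw [← ofReal_norm, ← ENNReal.ofReal_pow (norm_nonneg _), h1, ENNReal.ofReal_one]
  have hm : MemLp (𝓕 φ) 2 :=
    (memLp_congr_ae (l2Fourier_ae_eq_fourier hφ1 hφ2)).1 (memLp_l2Fourier hφ2)
  have hfin : ∫⁻ ω, ‖𝓕 φ ω‖ₑ ^ 2 ≠ ⊤ := by
    rw [lintegral_enorm_sq]
    exact ENNReal.pow_ne_top hm.2.ne
  have htop : ∫⁻ ω in Set.Ioi (0 : ℝ), ‖𝓕 φ ω‖ₑ ^ 2 = ⊤ := by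
    rw [setLIntegral_congr_fun_ae measurableSet_Ioi hone]
    simp
  exact hfin (top_le_iff.1 (htop ▸ setLIntegral_le_lintegral _ _))

theorem capturesEnergy_weylHeisenberg {R : ℝ} {φ g : ℝ → ℂ} (hφ1 : MemLp φ 1) (hφ2 : MemLp φ 2)
    (hg1 : MemLp g 1) (hg2 : MemLp g 2) (hsupp : tsupport (𝓕 g) ⊆ Set.Icc (-R) R)
    (hR : 0 < R) (hF : (weylHeisenbergBank R φ g).FrameCondition 1 1) {l : ℝ} (hl : 1 < l)
    {ε : ℝ} (hε0 : 0 < ε) (hε1 : ε < 1) {L : ℝ}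
    {f : Lp (α := ℝ) ℂ 2 volume} (hf0 : f ≠ 0) (hfL : BandLimited f L) {N : ℕ}
    (hN : ⌈Real.logb (3 / 2) (L / ((1 - (1 - ε) ^ (1 / (2 * l))) * R))⌉ ≤ (N : ℤ)) :
    CapturesEnergy (fun _ => weylHeisenbergBank R φ g) f ε N := by
  have hl0 : 0 < l := by linarith
  have hc := one_sub_rpow_pos hε0 hε1 hl0
  have hmem : ∀ k, ∃ (σ : ℝ) (n : ℕ), |σ| = 1 ∧ 1 ≤ n ∧
      (∀ p, MemLp g p → MemLp ((weylHeisenbergBank R φ g).g k) p) ∧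
      ∀ w, 𝓕 ((weylHeisenbergBank R φ g).g k) w ≠ 0 →
        ∃ t, n * R ≤ t ∧ t ≤ (n + 2) * R ∧ w = σ * t := by
    intro k
    obtain ⟨σ, n, hσ, hn, hk⟩ := weylHeisenbergBank_g R φ g k
    have hσσ : σ * σ = 1 := by rw [← abs_mul_abs_self, hσ, one_mul]
    rw [hk]
    refine ⟨σ, n, hσ, hn, fun p hp => hp.of_le ?_ (Filter.Eventually.of_forall fun x => ?_),
      fun w hw => ?_⟩
    · refine AEStronglyMeasurable.mul (Continuous.aestronglyMeasurable ?_) hp.1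
      exact continuous_subtype_val.comp (Real.continuous_fourierChar.comp (by fun_prop))
    · rw [norm_mul, Circle.norm_coe, one_mul]
    · rw [fourier_fourierChar_mul] at hw
      obtain ⟨h1, h2⟩ := tsupport_fourier_mem hsupp hw
      refine ⟨σ * w, ?_, ?_, by rw [← mul_assoc, hσσ, one_mul]⟩
      · rcases eq_or_eq_neg_of_abs_eq hσ with rfl | rfl <;> linarith
      · rcases eq_or_eq_neg_of_abs_eq hσ with rfl | rfl <;> linarith
  choose σ n hσ hn hp hw using hmem
  refine capturesEnergy_of_radii (R := fun k => (3 / 2 : ℝ) ^ k * R)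
    (fun _ => ⟨⟨hφ1, hφ2⟩, fun j => ⟨hp j 1 hg1, hp j 2 hg2⟩⟩) (fun _ => hF)
    (fun k => by positivity) (fun _ j => Filter.Eventually.of_forall fun w hne => ?_)
    -- Since `n ≥ 1`, the support `[nR, (n + 2)R]` lies in `[nR, 5nR]`. The harmonic mean `5nR/3` of
    -- these endpoints gives the ratio `2/3`, hence `a = 3/2`.
    (fun _ k j => ⟨σ j * (5 / 3 * n j * R), fun w hne _ _ => ?_⟩) hl0
    (fun w hw => rpow_le_ballOverlap_real hl.le hw) hε0 hε1 hf0 hfL ?_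
  · obtain ⟨t, h1, h2, rfl⟩ := hw j w hne
    have hnR : R ≤ n j * R := le_mul_of_one_le_left hR.le (by exact_mod_cast hn j)
    rw [pow_zero, one_mul, norm_mul, Real.norm_eq_abs, hσ, one_mul,
      Real.norm_of_nonneg (by linarith)]
    linarith
  · obtain ⟨t, h1, h2, rfl⟩ := hw j w hne
    have hnR : R ≤ n j * R := le_mul_of_one_le_left hR.le (by exact_mod_cast hn j)
    have h3 : |t - 5 / 3 * n j * R| ≤ 2 / 3 * t := abs_le.2 ⟨by linarith, by linarith⟩
    rw [← mul_sub, norm_mul, norm_mul, Real.norm_eq_abs (σ j), hσ, one_mul, one_mul,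
      Real.norm_eq_abs, Real.norm_of_nonneg (by linarith : 0 ≤ t), pow_succ]
    calc (3 / 2 : ℝ) ^ k * (3 / 2) * R * |t - 5 / 3 * n j * R|
        ≤ (3 / 2 : ℝ) ^ k * (3 / 2) * R * (2 / 3 * t) := by gcongr
      _ = (3 / 2 : ℝ) ^ k * R * t := by ring
  · have h := le_pow_of_ceil_logb_le (by norm_num) hN
    rw [div_le_iff₀ (by positivity)] at h
    linarith

end Line

end Scattering

end

open Scattering in
theorem corollary1 :
    -- general filters: polynomially many layers
    (∀ (d : ℕ), 1 ≤ d →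
      ∀ (Λ : ℕ → Type*) [∀ n, Countable (Λ n)]
        (Ω : ∀ n, FilterBank (EuclideanSpace ℝ (Fin d)) (Λ n)),
      (∀ n, (Ω n).InL1L2) → (∀ n, (Ω n).FrameCondition 1 1) →
      OrthantSupported Ω →
      ∀ δ : ℝ, 0 < δ → SpectralGap Ω δ →
      ∀ l : ℝ, ((d / 2 : ℕ) : ℝ) + 1 < l →
      ∀ ε : ℝ, 0 < ε → ε < 1 →
      ∀ L : ℝ, 0 ≤ L →
      ∀ f : Lp (α := EuclideanSpace ℝ (Fin d)) ℂ 2 volume, f ≠ 0 → BandLimited f L →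
      ∀ N : ℕ,
        ⌈(L / ((1 - (1 - ε) ^ (1 / (2 * l))) * δ)) ^ (1 / decayExponent d) - 1⌉ ≤ (N : ℤ) →
        CapturesEnergy Ω f ε N) ∧
    -- wavelets: `a = 5/3`, `δ = 1`
    (∀ φ ψ : ℝ → ℂ, MemLp φ 1 volume → MemLp φ 2 volume → MemLp ψ 1 volume → MemLp ψ 2 volume →
      tsupport (𝓕 ψ) ⊆ Set.Icc (1 / 2) 2 →
      (∀ᵐ ω : ℝ, 0 ≤ ω →
        HasSum (fun j : ℕ => ‖𝓕 ψ ((2 : ℝ) ^ (-((j : ℤ) + 1)) * ω)‖ ^ 2) (1 - ‖𝓕 φ ω‖ ^ 2)) →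
      (waveletBank φ ψ).FrameCondition 1 1 →
      ∀ l : ℝ, 1 < l →
      ∀ ε : ℝ, 0 < ε → ε < 1 →
      ∀ L : ℝ, 0 ≤ L →
      ∀ f : Lp (α := ℝ) ℂ 2 volume, f ≠ 0 → BandLimited f L →
      ∀ N : ℕ,
        ⌈Real.logb (5 / 3) (L / ((1 - (1 - ε) ^ (1 / (2 * l))) * 1))⌉ ≤ (N : ℤ) →
        CapturesEnergy (fun _ => waveletBank φ ψ) f ε N) ∧
    -- Weyl-Heisenberg filters: `a = 3/2`, `δ = R`
    (∀ (R : ℝ) (φ g : ℝ → ℂ),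
      MemLp φ 1 volume → MemLp φ 2 volume → MemLp g 1 volume → MemLp g 2 volume →
      tsupport (𝓕 g) ⊆ Set.Icc (-R) R →
      (∀ ω : ℝ, 𝓕 g (-ω) = 𝓕 g ω) →
      (∀ᵐ ω : ℝ, 0 ≤ ω →
        HasSum (fun k : ℕ => ‖𝓕 g (ω - R * (((k : ℝ) + 1) + 1))‖ ^ 2) (1 - ‖𝓕 φ ω‖ ^ 2)) →
      (weylHeisenbergBank R φ g).FrameCondition 1 1 →
      ∀ l : ℝ, 1 < l →
      ∀ ε : ℝ, 0 < ε → ε < 1 →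
      ∀ L : ℝ, 0 ≤ L →
      ∀ f : Lp (α := ℝ) ℂ 2 volume, f ≠ 0 → BandLimited f L →
      ∀ N : ℕ,
        ⌈Real.logb (3 / 2) (L / ((1 - (1 - ε) ^ (1 / (2 * l))) * R))⌉ ≤ (N : ℤ) →
        CapturesEnergy (fun _ => weylHeisenbergBank R φ g) f ε N) := by
  refine ⟨?_, ?_, ?_⟩
  · intro d hd Λ _ Ω hΩ hF hO δ hδ hgap l hl ε hε0 hε1 L hL f hf0 hfL N hN
    exact capturesEnergy_of_orthantSupported hd hΩ hF hO hδ hgap hl hε0 hε1 hL hf0 hfL hN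
  · intro φ ψ hφ1 hφ2 hψ1 hψ2 hsupp _ hF l hl ε hε0 hε1 L _ f hf0 hfL N hN
    exact capturesEnergy_wavelet hφ1 hφ2 hψ1 hψ2 hsupp hF hl hε0 hε1 hf0 hfL hN
  · intro R φ g hφ1 hφ2 hg1 hg2 hsupp _ hsum hF l hl ε hε0 hε1 L _ f hf0 hfL N hN
    exact capturesEnergy_weylHeisenberg hφ1 hφ2 hg1 hg2 hsupp
      (weylHeisenberg_modulation_pos hφ1 hφ2 hsupp hsum) hF hl hε0 hε1 hf0 hfL hN
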